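/- Let $\Bbbk$ be a field. Let $\mathcal{TL}_0(\Bbbk)$ be the strict $\Bbbk$-linear monoidal category with objects $[n]$, $n\in\mathbb N$, $[m]\otimes[n]=[m+n]$, generated by morphisms $\mathrm{cup}\colon[0]\to[2]$ and $\mathrm{cap}\colon[2]\to[0]$ subject to $\mathrm{cap}\circ\mathrm{cup}=\mathrm{id}_{[0]}$ and $(\mathrm{id}_{[1]}\otimes\mathrm{cap})\circ(\mathrm{cup}\otimes\mathrm{id}_{[1]})=0=(\mathrm{cap}\otimes\mathrm{id}_{[1]})\circ(\mathrm{id}_{[1]}\otimes\mathrm{cup})$. Let $f\mapsto\overline f$ be the contravariant $\Bbbk$-linear monoidal involution fixing objects and exchanging $\mathrm{cup}$ and $\mathrm{cap}$. A TL diagram (resp. cup diagram, cap diagram) is a non-zero morphism obtained from $\mathrm{cup},\mathrm{cap}$ and identities (resp. $\mathrm{cup}$ and identities, $\mathrm{cap}$ and identities) by tensoring and composition. The number $\mathtt{th}(f)$ of through-strands of a morphism $f$ is the least $l$ such that $f$ is a linear combination of morphisms factoring through objects $[j]$ with $j\le l$. Call $I\subseteq\{1,\dots,n\}$ apt if $n\notin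 I$ and $i\in I$ implies $i\pm1\notin I$; for apt $I$ let $\mathrm{cap}_{I,n}$ be the cap diagram with domain $[n]$ consisting of caps joining $i$ and $i+1$ for $i\in I$ and vertical strands elsewhere, let $\mathrm{cup}_{I,n}=\overline{\mathrm{cap}_{I,n}}$, and let $\mathrm j_n=\sum_{I\text{ apt}}(-1)^{|I|}\,\mathrm{cup}_{I,n}\circ\mathrm{cap}_{I,n}\in\mathrm{End}([n])$ be the Jones–Wenzl projector. Then the following hold. 1. Every TL diagram $x\colon[m]\to[n]$ can be written as $x=u\circ v$ with a cup diagram $u\colon[l]\to[n]$ and a cap diagram $v\colon[m]\to[l]$ for exactly one triple $(l,u,v)$. Conversely every such composite $u\circ v$ is a TL diagram, and $\mathtt{th}(u\circ v)=l$. Hence the max-summand morphism $\widehat x:=u\circ\mathrm j_{l}\circ v$ is well defined. 2. For all $m,n$, the family $(\widehat x)$, indexed by the TL diagrams $x\colon[m]\to[n]$, is a basis of $\mathrm{Hom}([m],[n])$. 3. For TL diagrams $x=u\circ v\colon[m]\to[n]$ and $x'=u'\circ v'\colon[n]\to[p]$ one has $\widehat{x'}\circ\widehat{x}=\widehat{u'\circ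 v}$ if $v'=\overline u$, and $\widehat{x'}\circ\widehat{x}=0$ otherwise. 4. Fix $m$. For each $l$ there are finitely many cup diagrams $[l]\to[m]$; let $r_l$ be their number. For $l\le m$ the span $\mathrm{End}([m])_{\mathtt{th}=l}$ of the $\widehat x$, with $x\colon[m]\to[m]$ a TL diagram such that $\mathtt{th}(x)=l$, is closed under multiplication, and summation is an isomorphism of algebras $\prod_{l\le m}\mathrm{End}([m])_{\mathtt{th}=l}\cong\mathrm{End}([m])$. For every enumeration $u^{(l)}_1,\dots,u^{(l)}_{r_l}$ of the cup diagrams $[l]\to[m]$, $l\le m$, there are algebra isomorphisms $\mathrm{End}([m])_{\mathtt{th}=l}\cong\mathrm{Mat}_{r_l}(\Bbbk)$ and $\mathrm{End}([m])\cong\prod_{l\le m}\mathrm{Mat}_{r_l}(\Bbbk)$ sending $u^{(l)}_a\circ\mathrm j_l\circ\overline{u^{(l)}_b}$ to the elementary matrix $E_{ab}$ (in the $l$-th factor, in the second case). -/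

import Mathlib

open CategoryTheory

universe u

namespace TLZero

/-- Formal expressions for the morphisms `m ⟶ n` of a `k`-linear strict monoidal category with
objects the natural numbers and `m ⊗ n = m + n`, generated by `cup : 0 ⟶ 2` and `cap : 2 ⟶ 0`.
Composition is written in diagrammatic order: `comp f g` is "first `f`, then `g`". -/
inductive Pre (k : Type u) : ℕ → ℕ → Type u
  | id (n : ℕ) : Pre k n n
  | cup : Pre k 0 2
  | cap : Pre k 2 0
  | comp {l m n : ℕ} (f : Pre k l m) (g : Pre k m n) : Pre k l n
  | tensor {m n p q : ℕ} (f : Pre k m n) (g : Pre k p q) : Pre k (m + p) (n + q)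
  | zero (m n : ℕ) : Pre k m n
  | add {m n : ℕ} (f g : Pre k m n) : Pre k m n
  | smul {m n : ℕ} (c : k) (f : Pre k m n) : Pre k m n

/-- Transport of an expression along equalities of objects (needed to state strictness). -/
def Pre.cast {k : Type u} {m n m' n' : ℕ} (hm : m = m') (hn : n = n') (f : Pre k m n) :
    Pre k m' n' :=
  match m', n', hm, hn with
  | _, _, rfl, rfl => f

/-- The congruence on expressions generated by the axioms of a `k`-linear strict monoidal category
together with the circle relation `cap ∘ cup = id₀` and the two zig-zag relations
`(id₁ ⊗ cap) ∘ (cup ⊗ id₁) = 0 = (cap ⊗ id₁) ∘ (id₁ ⊗ cup)`. -/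
inductive Rel (k : Type u) [Field k] : ∀ {m n : ℕ}, Pre k m n → Pre k m n → Prop
  -- equivalence relation, compatible with all operations
  | refl {m n : ℕ} (f : Pre k m n) : Rel k f f
  | symm {m n : ℕ} {f g : Pre k m n} : Rel k f g → Rel k g f
  | trans {m n : ℕ} {f g h : Pre k m n} : Rel k f g → Rel k g h → Rel k f h
  | comp_congr {l m n : ℕ} {f f' : Pre k l m} {g g' : Pre k m n} :
      Rel k f f' → Rel k g g' → Rel k (f.comp g) (f'.comp g')
  | tensor_congr {m n p q : ℕ} {f f' : Pre k m n} {g g' : Pre k p q} :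
      Rel k f f' → Rel k g g' → Rel k (f.tensor g) (f'.tensor g')
  | add_congr {m n : ℕ} {f f' g g' : Pre k m n} :
      Rel k f f' → Rel k g g' → Rel k (f.add g) (f'.add g')
  | smul_congr {m n : ℕ} (c : k) {f f' : Pre k m n} :
      Rel k f f' → Rel k (f.smul c) (f'.smul c)
  -- the morphisms `m ⟶ n` form a vector space
  | add_assoc {m n : ℕ} (f g h : Pre k m n) : Rel k ((f.add g).add h) (f.add (g.add h))
  | add_comm {m n : ℕ} (f g : Pre k m n) : Rel k (f.add g) (g.add f)
  | zero_add {m n : ℕ} (f : Pre k m n) : Rel k ((Pre.zero m n).add f) f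
  | smul_add {m n : ℕ} (c : k) (f g : Pre k m n) :
      Rel k ((f.add g).smul c) ((f.smul c).add (g.smul c))
  | add_smul {m n : ℕ} (c d : k) (f : Pre k m n) :
      Rel k (f.smul (c + d)) ((f.smul c).add (f.smul d))
  | mul_smul {m n : ℕ} (c d : k) (f : Pre k m n) : Rel k (f.smul (c * d)) ((f.smul d).smul c)
  | one_smul {m n : ℕ} (f : Pre k m n) : Rel k (f.smul 1) f
  | zero_smul {m n : ℕ} (f : Pre k m n) : Rel k (f.smul 0) (Pre.zero m n)
  -- category, with bilinear composition
  | id_comp {m n : ℕ} (f : Pre k m n) : Rel k ((Pre.id m).comp f) f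
  | comp_id {m n : ℕ} (f : Pre k m n) : Rel k (f.comp (Pre.id n)) f
  | comp_assoc {l m n p : ℕ} (f : Pre k l m) (g : Pre k m n) (h : Pre k n p) :
      Rel k ((f.comp g).comp h) (f.comp (g.comp h))
  | add_comp {l m n : ℕ} (f g : Pre k l m) (h : Pre k m n) :
      Rel k ((f.add g).comp h) ((f.comp h).add (g.comp h))
  | comp_add {l m n : ℕ} (f : Pre k l m) (g h : Pre k m n) :
      Rel k (f.comp (g.add h)) ((f.comp g).add (f.comp h))
  | smul_comp {l m n : ℕ} (c : k) (f : Pre k l m) (g : Pre k m n) :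
      Rel k ((f.smul c).comp g) ((f.comp g).smul c)
  | comp_smul {l m n : ℕ} (c : k) (f : Pre k l m) (g : Pre k m n) :
      Rel k (f.comp (g.smul c)) ((f.comp g).smul c)
  -- the tensor product is a bilinear bifunctor
  | add_tensor {m n p q : ℕ} (f g : Pre k m n) (h : Pre k p q) :
      Rel k ((f.add g).tensor h) ((f.tensor h).add (g.tensor h))
  | tensor_add {m n p q : ℕ} (f : Pre k m n) (g h : Pre k p q) :
      Rel k (f.tensor (g.add h)) ((f.tensor g).add (f.tensor h))
  | smul_tensor {m n p q : ℕ} (c : k) (f : Pre k m n) (g : Pre k p q) :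
      Rel k ((f.smul c).tensor g) ((f.tensor g).smul c)
  | tensor_smul {m n p q : ℕ} (c : k) (f : Pre k m n) (g : Pre k p q) :
      Rel k (f.tensor (g.smul c)) ((f.tensor g).smul c)
  | id_tensor_id (m n : ℕ) : Rel k ((Pre.id m).tensor (Pre.id n)) (Pre.id (m + n))
  | interchange {m n p m' n' p' : ℕ} (f : Pre k m n) (g : Pre k n p)
      (f' : Pre k m' n') (g' : Pre k n' p') :
      Rel k ((f.comp g).tensor (f'.comp g')) ((f.tensor f').comp (g.tensor g'))
  -- the tensor product is strictly associative and unital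
  | tensor_assoc {m n p q r s : ℕ} (f : Pre k m n) (g : Pre k p q) (h : Pre k r s) :
      Rel k (Pre.cast (Nat.add_assoc m p r) (Nat.add_assoc n q s) ((f.tensor g).tensor h))
        (f.tensor (g.tensor h))
  | id_zero_tensor {m n : ℕ} (f : Pre k m n) :
      Rel k (Pre.cast (Nat.zero_add m) (Nat.zero_add n) ((Pre.id 0).tensor f)) f
  | tensor_id_zero {m n : ℕ} (f : Pre k m n) :
      Rel k (Pre.cast (Nat.add_zero m) (Nat.add_zero n) (f.tensor (Pre.id 0))) f
  -- the defining relations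
  | circle : Rel k (Pre.cup.comp Pre.cap) (Pre.id 0)
  | zigzag_left :
      Rel k (Pre.comp (Pre.cast rfl rfl (Pre.cup.tensor (Pre.id 1)) : Pre k 1 3)
        (Pre.cast rfl rfl ((Pre.id 1).tensor Pre.cap) : Pre k 3 1)) (Pre.zero 1 1)
  | zigzag_right :
      Rel k (Pre.comp (Pre.cast rfl rfl ((Pre.id 1).tensor Pre.cup) : Pre k 1 3)
        (Pre.cast rfl rfl (Pre.cap.tensor (Pre.id 1)) : Pre k 3 1)) (Pre.zero 1 1)

/-- The setoid of the congruence `Rel`. -/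
def relSetoid (k : Type u) [Field k] (m n : ℕ) : Setoid (Pre k m n) :=
  ⟨Rel k, Rel.refl, Rel.symm, Rel.trans⟩

/-- The space of morphisms `m ⟶ n`. -/
def Mor (k : Type u) [Field k] (m n : ℕ) : Type u := Quotient (relSetoid k m n)

instance morZero (k : Type u) [Field k] (m n : ℕ) : Zero (Mor k m n) :=
  ⟨Quotient.mk _ (Pre.zero m n)⟩

instance morAdd (k : Type u) [Field k] (m n : ℕ) : Add (Mor k m n) :=
  ⟨Quotient.map₂ Pre.add fun _ _ h _ _ h' => Rel.add_congr h h'⟩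

instance morAddCommMonoid (k : Type u) [Field k] (m n : ℕ) : AddCommMonoid (Mor k m n) where
  add_assoc := by
    rintro ⟨f⟩ ⟨g⟩ ⟨h⟩
    exact Quotient.sound (Rel.add_assoc f g h)
  zero_add := by
    rintro ⟨f⟩
    exact Quotient.sound (Rel.zero_add f)
  add_zero := by
    rintro ⟨f⟩
    exact Quotient.sound (Rel.trans (Rel.add_comm _ _) (Rel.zero_add f))
  add_comm := by
    rintro ⟨f⟩ ⟨g⟩
    exact Quotient.sound (Rel.add_comm f g)
  nsmul := nsmulRec

instance morModule (k : Type u) [Field k] (m n : ℕ) : Module k (Mor k m n) where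
  smul c := Quotient.map (Pre.smul c) fun _ _ h => Rel.smul_congr c h
  one_smul := by
    rintro ⟨f⟩
    exact Quotient.sound (Rel.one_smul f)
  mul_smul := by
    rintro c d ⟨f⟩
    exact Quotient.sound (Rel.mul_smul c d f)
  smul_add := by
    rintro c ⟨f⟩ ⟨g⟩
    exact Quotient.sound (Rel.smul_add c f g)
  add_smul := by
    rintro c d ⟨f⟩
    exact Quotient.sound (Rel.add_smul c d f)
  zero_smul := by
    rintro ⟨f⟩
    exact Quotient.sound (Rel.zero_smul f)
  smul_zero := by
    intro c
    exact Quotient.sound (Rel.trans (Rel.smul_congr c (Rel.symm (Rel.zero_smul _)))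
      (Rel.trans (Rel.symm (Rel.mul_smul c 0 _))
        (by rw [mul_zero]; exact Rel.zero_smul (Pre.zero m n))))

instance morAddCommGroup (k : Type u) [Field k] (m n : ℕ) : AddCommGroup (Mor k m n) :=
  Module.addCommMonoidToAddCommGroup k

end TLZero

/-- The category `TL₀(k)`; its objects are the natural numbers. -/
structure TLZero (k : Type u) : Type where
  /-- the natural number `n` as an object -/
  of (k) ::
  /-- the underlying natural number of an object -/
  strands : ℕ

namespace TLZero

instance category (k : Type u) [Field k] : Category.{u} (TLZero k) where
  Hom X Y := Mor k X.strands Y.strands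
  id X := Quotient.mk _ (Pre.id X.strands)
  comp := Quotient.map₂ Pre.comp fun _ _ h _ _ h' => Rel.comp_congr h h'
  id_comp := by
    rintro X Y ⟨f⟩
    exact Quotient.sound (Rel.id_comp f)
  comp_id := by
    rintro X Y ⟨f⟩
    exact Quotient.sound (Rel.comp_id f)
  assoc := by
    rintro W X Y Z ⟨f⟩ ⟨g⟩ ⟨h⟩
    exact Quotient.sound (Rel.comp_assoc f g h)

instance preadditive (k : Type u) [Field k] : Preadditive (TLZero k) where
  homGroup X Y := morAddCommGroup k X.strands Y.strands
  add_comp := by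
    rintro X Y Z ⟨f⟩ ⟨g⟩ ⟨h⟩
    exact Quotient.sound (Rel.add_comp f g h)
  comp_add := by
    rintro X Y Z ⟨f⟩ ⟨g⟩ ⟨h⟩
    exact Quotient.sound (Rel.comp_add f g h)

instance linear (k : Type u) [Field k] : Linear k (TLZero k) where
  homModule X Y := morModule k X.strands Y.strands
  smul_comp := by
    rintro X Y Z c ⟨f⟩ ⟨g⟩
    exact Quotient.sound (Rel.smul_comp c f g)
  comp_smul := by
    rintro X Y Z ⟨f⟩ c ⟨g⟩
    exact Quotient.sound (Rel.comp_smul c f g)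

/-- The generator `cup : 0 ⟶ 2`. -/
def cup (k : Type u) [Field k] : of k 0 ⟶ of k 2 := Quotient.mk (relSetoid k 0 2) Pre.cup

/-- The generator `cap : 2 ⟶ 0`. -/
def cap (k : Type u) [Field k] : of k 2 ⟶ of k 0 := Quotient.mk (relSetoid k 2 0) Pre.cap

/-- The tensor product (horizontal juxtaposition) of morphisms. -/
def tensor {k : Type u} [Field k] {m n p q : ℕ} (f : of k m ⟶ of k n) (g : of k p ⟶ of k q) :
    of k (m + p) ⟶ of k (n + q) :=
  Quotient.map₂ (sa := relSetoid k m n) (sb := relSetoid k p q)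
    (sc := relSetoid k (m + p) (n + q)) Pre.tensor
    (fun _ _ h _ _ h' => Rel.tensor_congr h h') f g

/-- Reflection of an expression in a horizontal line. -/
def Pre.flip {k : Type u} : ∀ {m n : ℕ}, Pre k m n → Pre k n m
  | _, _, .id n => .id n
  | _, _, .cup => .cap
  | _, _, .cap => .cup
  | _, _, .comp f g => .comp g.flip f.flip
  | _, _, .tensor f g => .tensor f.flip g.flip
  | _, _, .zero m n => .zero n m
  | _, _, .add f g => .add f.flip g.flip
  | _, _, .smul c f => .smul c f.flip

theorem Pre.flip_cast {k : Type u} {m n m' n' : ℕ} (hm : m = m') (hn : n = n') (f : Pre k m n) :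
    (Pre.cast hm hn f).flip = Pre.cast hn hm f.flip := by
  subst hm hn
  rfl

theorem Rel.flip {k : Type u} [Field k] {m n : ℕ} {f g : Pre k m n} (h : Rel k f g) :
    Rel k f.flip g.flip := by
  induction h with
  | refl f => exact .refl _
  | symm _ ih => exact .symm ih
  | trans _ _ ih ih' => exact .trans ih ih'
  | comp_congr _ _ ih ih' => exact .comp_congr ih' ih
  | tensor_congr _ _ ih ih' => exact .tensor_congr ih ih'
  | add_congr _ _ ih ih' => exact .add_congr ih ih'
  | smul_congr c _ ih => exact .smul_congr c ih
  | add_assoc f g h => exact .add_assoc _ _ _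
  | add_comm f g => exact .add_comm _ _
  | zero_add f => exact .zero_add _
  | smul_add c f g => exact .smul_add _ _ _
  | add_smul c d f => exact .add_smul _ _ _
  | mul_smul c d f => exact .mul_smul _ _ _
  | one_smul f => exact .one_smul _
  | zero_smul f => exact .zero_smul _
  | id_comp f => exact .comp_id _
  | comp_id f => exact .id_comp _
  | comp_assoc f g h => exact .symm (.comp_assoc _ _ _)
  | add_comp f g h => exact .comp_add _ _ _
  | comp_add f g h => exact .add_comp _ _ _
  | smul_comp c f g => exact .comp_smul _ _ _
  | comp_smul c f g => exact .smul_comp _ _ _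
  | add_tensor f g h => exact .add_tensor _ _ _
  | tensor_add f g h => exact .tensor_add _ _ _
  | smul_tensor c f g => exact .smul_tensor _ _ _
  | tensor_smul c f g => exact .tensor_smul _ _ _
  | id_tensor_id m n => exact .id_tensor_id _ _
  | interchange f g f' g' => exact .interchange _ _ _ _
  | tensor_assoc f g h => rw [Pre.flip_cast]; exact .tensor_assoc _ _ _
  | id_zero_tensor f => rw [Pre.flip_cast]; exact .id_zero_tensor _
  | tensor_id_zero f => rw [Pre.flip_cast]; exact .tensor_id_zero _
  | circle => exact .circle
  | zigzag_left => exact .zigzag_right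
  | zigzag_right => exact .zigzag_left

/-- The contravariant `k`-linear monoidal involution of `TL₀(k)` that is the identity on objects and
exchanges `cup` and `cap`. -/
def bar {k : Type u} [Field k] {m n : ℕ} (f : of k m ⟶ of k n) : of k n ⟶ of k m :=
  Quotient.map (sa := relSetoid k m n) (sb := relSetoid k n m) Pre.flip
    (fun _ _ h => Rel.flip h) f

/-- Morphisms obtained from `cup`, `cap` and identities by tensoring and composition. -/
inductive IsWord {k : Type u} [Field k] : ∀ {m n : ℕ}, (of k m ⟶ of k n) → Prop
  | id (n : ℕ) : IsWord (𝟙 (of k n))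
  | cup : IsWord (cup k)
  | cap : IsWord (cap k)
  | comp {l m n : ℕ} {f : of k l ⟶ of k m} {g : of k m ⟶ of k n} :
      IsWord f → IsWord g → IsWord (f ≫ g)
  | tensor {m n p q : ℕ} {f : of k m ⟶ of k n} {g : of k p ⟶ of k q} :
      IsWord f → IsWord g → IsWord (tensor f g)

/-- Morphisms obtained from `cup` and identities by tensoring and composition. -/
inductive IsCupWord {k : Type u} [Field k] : ∀ {m n : ℕ}, (of k m ⟶ of k n) → Prop
  | id (n : ℕ) : IsCupWord (𝟙 (of k n))
  | cup : IsCupWord (cup k)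
  | comp {l m n : ℕ} {f : of k l ⟶ of k m} {g : of k m ⟶ of k n} :
      IsCupWord f → IsCupWord g → IsCupWord (f ≫ g)
  | tensor {m n p q : ℕ} {f : of k m ⟶ of k n} {g : of k p ⟶ of k q} :
      IsCupWord f → IsCupWord g → IsCupWord (tensor f g)

/-- Morphisms obtained from `cap` and identities by tensoring and composition. -/
inductive IsCapWord {k : Type u} [Field k] : ∀ {m n : ℕ}, (of k m ⟶ of k n) → Prop
  | id (n : ℕ) : IsCapWord (𝟙 (of k n))
  | cap : IsCapWord (cap k)
  | comp {l m n : ℕ} {f : of k l ⟶ of k m} {g : of k m ⟶ of k n} :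
      IsCapWord f → IsCapWord g → IsCapWord (f ≫ g)
  | tensor {m n p q : ℕ} {f : of k m ⟶ of k n} {g : of k p ⟶ of k q} :
      IsCapWord f → IsCapWord g → IsCapWord (tensor f g)

/-- Temperley–Lieb diagrams. -/
def IsTLDiagram {k : Type u} [Field k] {m n : ℕ} (f : of k m ⟶ of k n) : Prop :=
  IsWord f ∧ f ≠ 0

/-- Cup diagrams. -/
def IsCupDiagram {k : Type u} [Field k] {m n : ℕ} (f : of k m ⟶ of k n) : Prop :=
  IsCupWord f ∧ f ≠ 0

/-- Cap diagrams. -/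
def IsCapDiagram {k : Type u} [Field k] {m n : ℕ} (f : of k m ⟶ of k n) : Prop :=
  IsCapWord f ∧ f ≠ 0

/-- The type of cup diagrams from `l` to `m`. -/
abbrev CupDiagram (k : Type u) [Field k] (l m : ℕ) : Type u :=
  {f : of k l ⟶ of k m // IsCupDiagram f}

/-- The number `r` of cup diagrams from `l` to `m`. -/
noncomputable def cupCount (k : Type u) [Field k] (l m : ℕ) : ℕ := Nat.card (CupDiagram k l m)

/-- The ideal `th_{≤ l}` of `TL₀(k)`: the morphisms that are linear combinations of morphisms
factoring through an object with at most `l` strands. -/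
def throughIdeal (k : Type u) [Field k] (l m n : ℕ) : Submodule k (of k m ⟶ of k n) :=
  Submodule.span k {h | ∃ j ≤ l, ∃ (f : of k m ⟶ of k j) (g : of k j ⟶ of k n), f ≫ g = h}

/-- The number of through-strands `th f = min {l | f ∈ th_{≤ l}}`. -/
noncomputable def through {k : Type u} [Field k] {m n : ℕ} (f : of k m ⟶ of k n) : ℕ :=
  sInf {l | f ∈ throughIdeal k l m n}

/-- A finite set `I ⊆ {1, …, n}` is apt if `n ∉ I` and `i ∈ I` implies `i - 1, i + 1 ∉ I`. -/
def IsApt (n : ℕ) (I : Finset ℕ) : Prop :=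
  I ⊆ Finset.Icc 1 n ∧ n ∉ I ∧ ∀ i ∈ I, i - 1 ∉ I ∧ i + 1 ∉ I

/-- For an apt set `I`, the cap diagram `cap_{I,n}` on `n` strands (together with its number of
outgoing strands) with a cap joining `i` and `i + 1` for every `i ∈ I` and vertical strands at the
other positions. It is built from right to left. -/
noncomputable def capAt (k : Type u) [Field k] : (n : ℕ) → Finset ℕ → Σ r : ℕ, (of k n ⟶ of k r)
  | 0, _ => ⟨0, 𝟙 (of k 0)⟩
  | 1, _ => ⟨1, 𝟙 (of k 1)⟩
  | n + 2, I =>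
    if n + 1 ∈ I then ⟨(capAt k n I).1 + 0, tensor (capAt k n I).2 (cap k)⟩
    else
      ⟨(capAt k (n + 1) I).1 + 1, tensor (m := n + 1) (capAt k (n + 1) I).2 (𝟙 (of k 1))⟩

open Classical in
/-- The Jones–Wenzl projector `j_n = ∑_{I apt} (-1)^{|I|} cup_{I,n} ∘ cap_{I,n}`, where
`cup_{I,n}` is the reflection of `cap_{I,n}`. -/
noncomputable def jonesWenzl (k : Type u) [Field k] (n : ℕ) : of k n ⟶ of k n :=
  ∑ I ∈ (Finset.Icc 1 n).powerset.filter (IsApt n),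
    (-1 : k) ^ I.card • ((capAt k n I).2 ≫ bar (capAt k n I).2)

/-- `x = u ∘ v` with `u` a cup diagram and `v` a cap diagram. -/
def IsCupCap {k : Type u} [Field k] {m n : ℕ} (x : of k m ⟶ of k n) {l : ℕ}
    (u : of k l ⟶ of k n) (v : of k m ⟶ of k l) : Prop :=
  IsCupDiagram u ∧ IsCapDiagram v ∧ x = v ≫ u

open Classical in
/-- The max-summand morphism `u ∘ j_l ∘ v` of `x = u ∘ v` (and `0` if `x` is not of this form). -/
noncomputable def maxSummand {k : Type u} [Field k] {m n : ℕ} (x : of k m ⟶ of k n) :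
    of k m ⟶ of k n :=
  if h : ∃ p : Σ l : ℕ, (of k l ⟶ of k n) × (of k m ⟶ of k l), IsCupCap x p.2.1 p.2.2 then
    h.choose.2.2 ≫ jonesWenzl k h.choose.1 ≫ h.choose.2.1
  else 0

/-- The span of the max-summand morphisms of the diagrams `x : m ⟶ m` with `th x = l`. -/
def endThrough (k : Type u) [Field k] (l m : ℕ) : Submodule k (End (of k m)) :=
  Submodule.span k {f | ∃ x : of k m ⟶ of k m, IsTLDiagram x ∧ through x = l ∧ maxSummand x = f}

/-- The morphism `a ∘ j_l ∘ bar b` attached to two cup diagrams `a, b : l ⟶ m`. -/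
noncomputable def matrixUnit {k : Type u} [Field k] {l m : ℕ} (a b : CupDiagram k l m) :
    End (of k m) :=
  bar b.1 ≫ jonesWenzl k l ≫ a.1

end TLZero

namespace TLZero

theorem Pre.flip_flip {R : Type u} {m n : ℕ} (f : Pre R m n) : f.flip.flip = f := by
  induction f <;> simp_all [Pre.flip]

variable {k : Type u} [Field k]

/-! ### The monoidal structure on morphisms -/

theorem tensor_comp {m n p m' n' p' : ℕ} (f : of k m ⟶ of k n) (g : of k n ⟶ of k p)
    (f' : of k m' ⟶ of k n') (g' : of k n' ⟶ of k p') :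
    tensor (f ≫ g) (f' ≫ g') = tensor f f' ≫ tensor g g' := by
  induction f using Quotient.inductionOn
  induction g using Quotient.inductionOn
  induction f' using Quotient.inductionOn
  induction g' using Quotient.inductionOn
  exact Quotient.sound (Rel.interchange _ _ _ _)

theorem tensor_id (m n : ℕ) : tensor (𝟙 (of k m)) (𝟙 (of k n)) = 𝟙 (of k (m + n)) :=
  Quotient.sound (Rel.id_tensor_id m n)

theorem tensor_add {m n p q : ℕ} (f : of k m ⟶ of k n) (g h : of k p ⟶ of k q) :
    tensor f (g + h) = tensor f g + tensor f h := by
  induction f using Quotient.inductionOn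
  induction g using Quotient.inductionOn
  induction h using Quotient.inductionOn
  exact Quotient.sound (Rel.tensor_add _ _ _)

theorem add_tensor {m n p q : ℕ} (f g : of k m ⟶ of k n) (h : of k p ⟶ of k q) :
    tensor (f + g) h = tensor f h + tensor g h := by
  induction f using Quotient.inductionOn
  induction g using Quotient.inductionOn
  induction h using Quotient.inductionOn
  exact Quotient.sound (Rel.add_tensor _ _ _)

theorem smul_tensor {m n p q : ℕ} (c : k) (f : of k m ⟶ of k n) (g : of k p ⟶ of k q) :
    tensor (c • f) g = c • tensor f g := by
  induction f using Quotient.inductionOn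
  induction g using Quotient.inductionOn
  exact Quotient.sound (Rel.smul_tensor _ _ _)

/-- Tensoring on the right with a fixed morphism, as a linear map. -/
def tensorRight {p q : ℕ} (m n : ℕ) (h : of k p ⟶ of k q) :
    (of k m ⟶ of k n) →ₗ[k] (of k (m + p) ⟶ of k (n + q)) where
  toFun f := tensor f h
  map_add' f g := add_tensor f g h
  map_smul' c f := smul_tensor c f h

theorem tensor_zero {m n p q : ℕ} (f : of k m ⟶ of k n) :
    tensor f (0 : of k p ⟶ of k q) = 0 := by
  have h := tensor_add f (0 : of k p ⟶ of k q) 0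
  rwa [add_zero, left_eq_add] at h

theorem zero_tensor {m n p q : ℕ} (f : of k p ⟶ of k q) :
    tensor (0 : of k m ⟶ of k n) f = 0 := map_zero (tensorRight m n f)

theorem tensor_smul {m n p q : ℕ} (c : k) (f : of k m ⟶ of k n) (g : of k p ⟶ of k q) :
    tensor f (c • g) = c • tensor f g := by
  induction f using Quotient.inductionOn
  induction g using Quotient.inductionOn
  exact Quotient.sound (Rel.tensor_smul _ _ _)

theorem id_zero_tensor_cup : tensor (𝟙 (of k 0)) (cup k) = cup k :=
  Quotient.sound (Rel.id_zero_tensor _)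

theorem tensor_id_zero {m n : ℕ} (f : of k m ⟶ of k n) : tensor f (𝟙 (of k 0)) = f := by
  induction f using Quotient.inductionOn
  exact Quotient.sound (Rel.tensor_id_zero _)

theorem cup_comp_cap : cup k ≫ cap k = 𝟙 (of k 0) := Quotient.sound Rel.circle

/-- Adding a vertical strand on the right. -/
def strand {m n : ℕ} (f : of k m ⟶ of k n) : of k (m + 1) ⟶ of k (n + 1) :=
  tensor f (𝟙 (of k 1))

/-- `l` vertical strands followed by a cup. -/
def cupLast (k : Type u) [Field k] (l : ℕ) : of k l ⟶ of k (l + 2) := tensor (𝟙 (of k l)) (cup k)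

/-- `l` vertical strands followed by a cap. -/
def capLast (k : Type u) [Field k] (l : ℕ) : of k (l + 2) ⟶ of k l := tensor (𝟙 (of k l)) (cap k)

theorem strand_comp {l m n : ℕ} (f : of k l ⟶ of k m) (g : of k m ⟶ of k n) :
    strand (f ≫ g) = strand f ≫ strand g := by
  unfold strand
  rw [← tensor_comp, Category.comp_id]

theorem strand_id (n : ℕ) : strand (𝟙 (of k n)) = 𝟙 (of k (n + 1)) := tensor_id n 1

theorem strand_sub {m n : ℕ} (f g : of k m ⟶ of k n) :
    strand (f - g) = strand f - strand g := map_sub (tensorRight m n (𝟙 (of k 1))) f g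

theorem strand_zero (m n : ℕ) : strand (0 : of k m ⟶ of k n) = 0 :=
  map_zero (tensorRight m n (𝟙 (of k 1)))

theorem tensor_strand {m n p q : ℕ} (f : of k m ⟶ of k n) (g : of k p ⟶ of k q) :
    tensor f (strand g) = strand (tensor f g) := by
  induction f using Quotient.inductionOn with | _ f
  induction g using Quotient.inductionOn with | _ g
  exact Quotient.sound (Rel.symm (Rel.tensor_assoc f g (Pre.id 1)))

theorem id_tensor_cupLast (l l' : ℕ) :
    tensor (𝟙 (of k l)) (cupLast k l') = cupLast k (l + l') := by
  have h : tensor (𝟙 (of k l)) (cupLast k l') = tensor (tensor (𝟙 (of k l)) (𝟙 (of k l'))) (cup k) :=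
    Quotient.sound (Rel.symm (Rel.tensor_assoc (Pre.id l) (Pre.id l') Pre.cup))
  rw [h, tensor_id]
  rfl

theorem id_tensor_capLast (l l' : ℕ) :
    tensor (𝟙 (of k l)) (capLast k l') = capLast k (l + l') := by
  have h : tensor (𝟙 (of k l)) (capLast k l') = tensor (tensor (𝟙 (of k l)) (𝟙 (of k l'))) (cap k) :=
    Quotient.sound (Rel.symm (Rel.tensor_assoc (Pre.id l) (Pre.id l') Pre.cap))
  rw [h, tensor_id]
  rfl

theorem strand_strand {m n : ℕ} (f : of k m ⟶ of k n) :
    strand (strand f) = tensor f (𝟙 (of k 2)) := by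
  rw [strand, strand, ← tensor_id 1 1]
  exact (tensor_strand f (𝟙 (of k 1))).symm

theorem tensor_cup {m n : ℕ} (f : of k m ⟶ of k n) :
    tensor f (cup k) = f ≫ cupLast k n := by
  have h := tensor_comp f (𝟙 _) (𝟙 _) (cup k)
  rw [Category.comp_id, Category.id_comp, tensor_id_zero] at h
  exact h

theorem tensor_cap {m n : ℕ} (f : of k m ⟶ of k n) :
    tensor f (cap k) = capLast k m ≫ f := by
  have h := tensor_comp (𝟙 _) f (cap k) (𝟙 _)
  rw [Category.comp_id, Category.id_comp, tensor_id_zero] at h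
  exact h

theorem cupLast_comp_strand_strand {m n : ℕ} (f : of k m ⟶ of k n) :
    cupLast k m ≫ strand (strand f) = f ≫ cupLast k n := by
  rw [strand_strand, ← tensor_cup]
  have h := tensor_comp (𝟙 _) f (cup k) (𝟙 _)
  rw [Category.comp_id, Category.id_comp] at h
  exact h.symm

theorem strand_strand_comp_capLast {m n : ℕ} (f : of k m ⟶ of k n) :
    strand (strand f) ≫ capLast k n = capLast k m ≫ f := by
  rw [strand_strand, ← tensor_cap]
  have h := tensor_comp f (𝟙 _) (𝟙 _) (cap k)
  rw [Category.comp_id, Category.id_comp] at h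
  exact h.symm

theorem cupLast_comp_capLast (l : ℕ) : cupLast k l ≫ capLast k l = 𝟙 (of k l) := by
  have h := tensor_comp (𝟙 (of k l)) (𝟙 _) (cup k) (cap k)
  rw [Category.comp_id, cup_comp_cap, tensor_id] at h
  exact h.symm

theorem cupLast_comp_strand_capLast (j : ℕ) :
    cupLast k (j + 1) ≫ strand (capLast k j) = 0 := by
  have h : tensor (𝟙 (of k 1)) (cup k) ≫ strand (cap k) = 0 :=
    Quotient.sound Rel.zigzag_right
  have h' := tensor_comp (𝟙 (of k j)) (𝟙 _) (tensor (𝟙 (of k 1)) (cup k)) (strand (cap k))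
  rw [h, tensor_zero, tensor_strand] at h'
  rw [← id_tensor_cupLast j 1]
  exact h'.symm

theorem strand_cupLast_comp_capLast (j : ℕ) :
    strand (cupLast k j) ≫ capLast k (j + 1) = 0 := by
  have h : (strand (cup k) : of k 1 ⟶ of k 3) ≫
      (tensor (p := 2) (q := 0) (𝟙 (of k 1)) (cap k) : of k 3 ⟶ of k 1) = 0 :=
    Quotient.sound Rel.zigzag_left
  have h' := tensor_comp (𝟙 (of k j)) (𝟙 _) (strand (cup k) : of k 1 ⟶ of k 3)
    (tensor (p := 2) (q := 0) (𝟙 (of k 1)) (cap k) : of k 3 ⟶ of k 1)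
  rw [h, tensor_zero] at h'
  rw [← id_tensor_capLast j 1]
  refine Eq.trans ?_ h'.symm
  exact congrArg (· ≫ tensor (𝟙 (of k j)) (capLast k 1)) (tensor_strand (𝟙 (of k j)) (cup k)).symm

/-! ### The involution -/

theorem bar_comp {l m n : ℕ} (f : of k l ⟶ of k m) (g : of k m ⟶ of k n) :
    bar (f ≫ g) = bar g ≫ bar f := by
  induction f using Quotient.inductionOn
  induction g using Quotient.inductionOn
  rfl

theorem bar_tensor {m n p q : ℕ} (f : of k m ⟶ of k n) (g : of k p ⟶ of k q) :
    bar (tensor f g) = tensor (bar f) (bar g) := by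
  induction f using Quotient.inductionOn
  induction g using Quotient.inductionOn
  rfl

theorem bar_add {m n : ℕ} (f g : of k m ⟶ of k n) : bar (f + g) = bar f + bar g := by
  induction f using Quotient.inductionOn
  induction g using Quotient.inductionOn
  rfl

theorem bar_zero (m n : ℕ) : bar (0 : of k m ⟶ of k n) = 0 := rfl

theorem bar_sub {m n : ℕ} (f g : of k m ⟶ of k n) : bar (f - g) = bar f - bar g :=
  map_sub (AddMonoidHom.mk' bar bar_add) f g

theorem bar_id (n : ℕ) : bar (𝟙 (of k n)) = 𝟙 (of k n) := rfl

theorem bar_bar {m n : ℕ} (f : of k m ⟶ of k n) : bar (bar f) = f := by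
  induction f using Quotient.inductionOn with | _ f
  exact congrArg _ (Pre.flip_flip f)

theorem bar_strand {m n : ℕ} (f : of k m ⟶ of k n) : bar (strand f) = strand (bar f) :=
  bar_tensor _ _

theorem bar_cupLast (l : ℕ) : bar (cupLast k l) = capLast k l := rfl

theorem bar_capLast (l : ℕ) : bar (capLast k l) = cupLast k l := rfl

theorem IsCupWord.bar {m n : ℕ} {f : of k m ⟶ of k n} (h : IsCupWord f) :
    IsCapWord (bar f) := by
  induction h with
  | id n => exact .id n
  | cup => exact .cap
  | comp _ _ ih ih' => rw [bar_comp]; exact .comp ih' ih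
  | tensor _ _ ih ih' => rw [bar_tensor]; exact .tensor ih ih'

theorem IsCapWord.bar {m n : ℕ} {f : of k m ⟶ of k n} (h : IsCapWord f) :
    IsCupWord (bar f) := by
  induction h with
  | id n => exact .id n
  | cap => exact .cup
  | comp _ _ ih ih' => rw [bar_comp]; exact .comp ih' ih
  | tensor _ _ ih ih' => rw [bar_tensor]; exact .tensor ih ih'

theorem IsCupWord.isWord {m n : ℕ} {f : of k m ⟶ of k n} (h : IsCupWord f) : IsWord f := by
  induction h with
  | id n => exact .id n
  | cup => exact .cup
  | comp _ _ ih ih' => exact .comp ih ih'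
  | tensor _ _ ih ih' => exact .tensor ih ih'

theorem IsCapWord.isWord {m n : ℕ} {f : of k m ⟶ of k n} (h : IsCapWord f) : IsWord f := by
  induction h with
  | id n => exact .id n
  | cap => exact .cap
  | comp _ _ ih ih' => exact .comp ih ih'
  | tensor _ _ ih ih' => exact .tensor ih ih'

theorem IsCupWord.comp_bar {m n : ℕ} {f : of k m ⟶ of k n} (h : IsCupWord f) :
    f ≫ TLZero.bar f = 𝟙 _ := by
  induction h with
  | id n => exact Category.comp_id _
  | cup => exact cup_comp_cap
  | @comp l m n f g _ _ ih ih' =>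
    rw [bar_comp, Category.assoc, ← Category.assoc g, ih', Category.id_comp, ih]
  | tensor _ _ ih ih' => rw [bar_tensor, ← tensor_comp, ih, ih', tensor_id]

theorem IsCupWord.strand {m n : ℕ} {f : of k m ⟶ of k n} (h : IsCupWord f) :
    IsCupWord (strand f) := .tensor h (.id 1)

theorem IsCapWord.strand {m n : ℕ} {f : of k m ⟶ of k n} (h : IsCapWord f) :
    IsCapWord (strand f) := .tensor h (.id 1)

theorem isCupWord_cupLast (l : ℕ) : IsCupWord (cupLast k l) := .tensor (.id l) .cup

theorem isCapWord_capLast (l : ℕ) : IsCapWord (capLast k l) := .tensor (.id l) .cap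

/-! ### Ballot sequences -/

/-- Ballot sequences of length `m` and excess `l`: sequences of `m` steps `±1` with non-negative
partial sums and total sum `l`. -/
inductive Ballot : ℕ → ℕ → Type
  | nil : Ballot 0 0
  | up {l m : ℕ} (w : Ballot l m) : Ballot (l + 1) (m + 1)
  | down {l m : ℕ} (w : Ballot (l + 1) m) : Ballot l (m + 1)

/-- The word of a ballot sequence. -/
def Ballot.word : ∀ {l m : ℕ}, Ballot l m → List Bool
  | _, _, .nil => []
  | _, _, .up w => w.word ++ [true]
  | _, _, .down w => w.word ++ [false]

theorem Ballot.length_word {l m : ℕ} (w : Ballot l m) : w.word.length = m := by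
  induction w <;> simp_all [Ballot.word]

theorem Ballot.le {l m : ℕ} (w : Ballot l m) : l ≤ m := by
  induction w <;> omega

theorem Ballot.word_injective {l m : ℕ} (w w' : Ballot l m) (h : w.word = w'.word) : w = w' := by
  induction w with
  | nil => cases w'; rfl
  | up w ih =>
    cases w' with
    | up w' => simp only [word, List.append_cancel_right_eq] at h; rw [ih w' h]
    | down w' => simp [word] at h
  | down w ih =>
    cases w' with
    | up w' => simp [word] at h
    | down w' => simp only [word, List.append_cancel_right_eq] at h; rw [ih w' h]

instance Ballot.finite (l m : ℕ) : Finite (Ballot l m) := by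
  have := (List.finite_length_eq Bool m).to_subtype
  exact Finite.of_injective
    (fun w : Ballot l m => (⟨w.word, w.length_word⟩ : {a : List Bool | a.length = m}))
    fun w w' h => w.word_injective w' (congrArg Subtype.val h)

/-- The cup diagram of a ballot sequence: each step down closes the last open strand. -/
def Ballot.diagram (k : Type u) [Field k] : ∀ {l m : ℕ}, Ballot l m → (of k l ⟶ of k m)
  | _, _, .nil => 𝟙 (of k 0)
  | _, _, .up w => strand (w.diagram k)
  | l, _, .down w => cupLast k l ≫ strand (w.diagram k)

theorem Ballot.isCupWord {l m : ℕ} (w : Ballot l m) : IsCupWord (w.diagram k) := by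
  induction w with
  | nil => exact .id 0
  | up w ih => exact ih.strand
  | down w ih => exact .comp (isCupWord_cupLast _) ih.strand

theorem Ballot.diagram_self {m : ℕ} (w : Ballot m m) : w.diagram k = 𝟙 (of k m) := by
  induction m with
  | zero => cases w; rfl
  | succ m ih =>
    cases w with
    | up w => rw [diagram, ih, strand_id]
    | down w => have := w.le; omega

theorem Ballot.exists_id (n : ℕ) : ∃ w : Ballot n n, w.diagram k = 𝟙 (of k n) := by
  induction n with
  | zero => exact ⟨.nil, rfl⟩
  | succ n ih =>
    obtain ⟨w, hw⟩ := ih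
    exact ⟨.up w, by rw [diagram, hw, strand_id]⟩

theorem Ballot.exists_comp {l m n : ℕ} (w : Ballot l m) (w' : Ballot m n) :
    ∃ w'' : Ballot l n, w''.diagram k = w.diagram k ≫ w'.diagram k := by
  induction w' generalizing l with
  | nil => exact ⟨w, (Category.comp_id _).symm⟩
  | up w' ih =>
    cases w with
    | up w =>
      obtain ⟨x, hx⟩ := ih w
      exact ⟨.up x, by rw [diagram, hx, strand_comp]; rfl⟩
    | down w =>
      obtain ⟨x, hx⟩ := ih w
      refine ⟨.down x, ?_⟩
      change _ ≫ strand (x.diagram k) = (_ ≫ strand (w.diagram k)) ≫ strand (w'.diagram k)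
      rw [hx, strand_comp, Category.assoc]
  | down w' ih =>
    obtain ⟨x, hx⟩ := ih (.up w)
    refine ⟨.down x, ?_⟩
    change _ ≫ strand (x.diagram k) = w.diagram k ≫ _ ≫ strand (w'.diagram k)
    rw [hx, diagram, strand_comp, ← Category.assoc, cupLast_comp_strand_strand, Category.assoc]

theorem Ballot.exists_tensor {l m l' m' : ℕ} (w : Ballot l m) (w' : Ballot l' m') :
    ∃ w'' : Ballot (l + l') (m + m'),
      w''.diagram k = tensor (w.diagram k) (w'.diagram k) := by
  induction w' with
  | nil => exact ⟨w, (tensor_id_zero _).symm⟩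
  | up w' ih =>
    obtain ⟨x, hx⟩ := ih
    exact ⟨.up x, by rw [diagram, hx, diagram, tensor_strand]⟩
  | @down l' m' w' ih =>
    obtain ⟨x, hx⟩ := ih
    refine ⟨.down x, ?_⟩
    have h := tensor_comp (𝟙 (of k l)) (w.diagram k) (cupLast k l') (strand (w'.diagram k))
    rw [Category.id_comp, id_tensor_cupLast, tensor_strand] at h
    rw [diagram, hx, diagram]
    exact h.symm

theorem IsCupWord.exists_ballot {l m : ℕ} {u : of k l ⟶ of k m} (h : IsCupWord u) :
    ∃ w : Ballot l m, w.diagram k = u := by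
  induction h with
  | id n => exact Ballot.exists_id n
  | cup =>
    refine ⟨.down (.up .nil), ?_⟩
    rw [Ballot.diagram, Ballot.diagram, Ballot.diagram, strand_id, strand_id, Category.comp_id]
    exact id_zero_tensor_cup
  | comp _ _ ih ih' =>
    obtain ⟨w, rfl⟩ := ih
    obtain ⟨w', rfl⟩ := ih'
    exact w.exists_comp w'
  | tensor _ _ ih ih' =>
    obtain ⟨w, rfl⟩ := ih
    obtain ⟨w', rfl⟩ := ih'
    exact w.exists_tensor w'

theorem IsCapWord.exists_ballot {m l : ℕ} {v : of k m ⟶ of k l} (h : IsCapWord v) :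
    ∃ w : Ballot l m, TLZero.bar (w.diagram k) = v := by
  obtain ⟨w, hw⟩ := h.bar.exists_ballot
  exact ⟨w, by rw [hw, bar_bar]⟩

theorem IsCupWord.le {l m : ℕ} {u : of k l ⟶ of k m} (h : IsCupWord u) : l ≤ m :=
  h.exists_ballot.elim fun w _ => w.le

theorem IsCapWord.le {m l : ℕ} {v : of k m ⟶ of k l} (h : IsCapWord v) : l ≤ m :=
  h.bar.le

theorem IsCupWord.eq_id {m : ℕ} {u : of k m ⟶ of k m} (h : IsCupWord u) : u = 𝟙 _ := by
  obtain ⟨w, rfl⟩ := h.exists_ballot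
  exact w.diagram_self

theorem IsCapWord.eq_id {m : ℕ} {v : of k m ⟶ of k m} (h : IsCapWord v) : v = 𝟙 _ := by
  rw [← bar_bar v, h.bar.eq_id, bar_id]

/-! ### The crystal representation -/

/-- The words of length `n` in two letters. -/
noncomputable def words (n : ℕ) : Finset (List Bool) := (List.finite_length_eq Bool n).toFinset

theorem mem_words {n : ℕ} {a : List Bool} : a ∈ words n ↔ a.length = n := by
  simp [words]

theorem sum_words_add {M : Type*} [NonUnitalNonAssocSemiring M] (m n : ℕ) (φ ψ : List Bool → M) :
    ∑ x ∈ words (m + n), φ (x.take m) * ψ (x.drop m) =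
      (∑ x ∈ words m, φ x) * ∑ y ∈ words n, ψ y := by
  rw [Finset.sum_mul_sum, ← Finset.sum_product']
  refine Finset.sum_nbij' (fun x => (x.take m, x.drop m)) (fun p => p.1 ++ p.2) ?_ ?_ ?_ ?_ ?_
  · intro x hx
    rw [mem_words] at hx
    simp [mem_words, hx]
  · rintro ⟨x, y⟩ hx
    simp only [Finset.mem_product, mem_words] at hx
    simp [mem_words, hx.1, hx.2]
  · intro x _
    simp
  · rintro ⟨x, y⟩ hx
    simp only [Finset.mem_product, mem_words] at hx
    simp [← hx.1]
  · intro x _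
    rfl

/-- The matrix coefficients of the monoidal functor to vector spaces that sends the object `1` to
the space with basis `true, false`, `cup` to `true ⊗ false` and `cap` to its dual functional. -/
noncomputable def Pre.coeff {k : Type u} [Field k] : ∀ {m n : ℕ}, Pre k m n → List Bool → List Bool → k
  | _, _, .id _, a, b => if a = b then 1 else 0
  | _, _, .cup, _, b => if b = [true, false] then 1 else 0
  | _, _, .cap, a, _ => if a = [true, false] then 1 else 0
  | _, _, .comp (m := m) f g, a, b => ∑ x ∈ words m, f.coeff a x * g.coeff x b
  | _, _, .tensor (m := m) (n := n) f g, a, b =>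
    f.coeff (a.take m) (b.take n) * g.coeff (a.drop m) (b.drop n)
  | _, _, .zero _ _, _, _ => 0
  | _, _, .add f g, a, b => f.coeff a b + g.coeff a b
  | _, _, .smul c f, a, b => c * f.coeff a b

theorem Pre.coeff_cast {m n m' n' : ℕ} (hm : m = m') (hn : n = n') (f : Pre k m n)
    (a b : List Bool) : (Pre.cast hm hn f).coeff a b = f.coeff a b := by
  subst hm hn
  rfl

theorem Rel.coeff {m n : ℕ} {f g : Pre k m n} (h : Rel k f g) (a b : List Bool)
    (ha : a.length = m) (hb : b.length = n) : f.coeff a b = g.coeff a b := by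
  induction h generalizing a b with
  | refl f => rfl
  | symm _ ih => exact (ih a b ha hb).symm
  | trans _ _ ih ih' => exact (ih a b ha hb).trans (ih' a b ha hb)
  | comp_congr _ _ ih ih' =>
    refine Finset.sum_congr rfl fun x hx => ?_
    rw [mem_words] at hx
    rw [ih a x ha hx, ih' x b hx hb]
  | tensor_congr _ _ ih ih' =>
    rw [Pre.coeff, Pre.coeff, ih _ _ (by simp [ha]) (by simp [hb]),
      ih' _ _ (by simp [ha]) (by simp [hb])]
  | add_congr _ _ ih ih' => rw [Pre.coeff, Pre.coeff, ih a b ha hb, ih' a b ha hb]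
  | smul_congr c _ ih => rw [Pre.coeff, Pre.coeff, ih a b ha hb]
  | add_assoc f g h => exact _root_.add_assoc _ _ _
  | add_comm f g => exact _root_.add_comm _ _
  | zero_add f => exact _root_.zero_add _
  | smul_add c f g => exact _root_.mul_add _ _ _
  | add_smul c d f => exact _root_.add_mul _ _ _
  | mul_smul c d f => exact _root_.mul_assoc _ _ _
  | one_smul f => exact _root_.one_mul _
  | zero_smul f => exact MulZeroClass.zero_mul _
  | id_comp f => simp [Pre.coeff, mem_words, ha]
  | comp_id f => simp [Pre.coeff, mem_words, hb]
  | comp_assoc f g h =>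
    simp only [Pre.coeff, Finset.sum_mul, Finset.mul_sum, _root_.mul_assoc]
    exact Finset.sum_comm
  | add_comp f g h => simp only [Pre.coeff, _root_.add_mul, Finset.sum_add_distrib]
  | comp_add f g h => simp only [Pre.coeff, _root_.mul_add, Finset.sum_add_distrib]
  | smul_comp c f g => simp only [Pre.coeff, Finset.mul_sum, _root_.mul_assoc]
  | comp_smul c f g => simp only [Pre.coeff, Finset.mul_sum, mul_left_comm]
  | add_tensor f g h => exact _root_.add_mul _ _ _
  | tensor_add f g h => exact _root_.mul_add _ _ _
  | smul_tensor c f g => exact _root_.mul_assoc _ _ _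
  | tensor_smul c f g => exact mul_left_comm _ _ _
  | id_tensor_id m n =>
    simp only [Pre.coeff]
    rw [ite_zero_mul_ite_zero, mul_one]
    refine if_congr ⟨fun h => ?_, fun h => by simp [h]⟩ rfl rfl
    rw [← List.take_append_drop m a, h.1, h.2, List.take_append_drop]
  | @interchange m n p m' n' p' f g f' g' =>
    simp only [Pre.coeff]
    rw [← sum_words_add]
    exact Finset.sum_congr rfl fun x _ => mul_mul_mul_comm _ _ _ _
  | @tensor_assoc m n p q r s f g h =>
    rw [Pre.coeff_cast]
    simp only [Pre.coeff, List.take_take, List.drop_take, List.drop_drop, _root_.mul_assoc]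
    simp
  | id_zero_tensor f =>
    rw [Pre.coeff_cast]
    simp [Pre.coeff]
  | tensor_id_zero f =>
    rw [Pre.coeff_cast]
    subst ha hb
    simp [Pre.coeff]
  | circle =>
    rw [List.length_eq_zero_iff] at ha hb
    subst ha hb
    simp [Pre.coeff, mem_words]
  | zigzag_left =>
    refine Finset.sum_eq_zero fun x hx => ?_
    rw [mem_words] at hx
    obtain ⟨x₁, x₂, x₃, rfl⟩ := List.length_eq_three.mp hx
    simp only [Pre.coeff_cast, Pre.coeff]
    cases x₂ <;> simp
  | zigzag_right =>
    refine Finset.sum_eq_zero fun x hx => ?_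
    rw [mem_words] at hx
    obtain ⟨x₁, x₂, x₃, rfl⟩ := List.length_eq_three.mp hx
    simp only [Pre.coeff_cast, Pre.coeff]
    cases x₂ <;> simp

/-- The matrix coefficient of a morphism in the crystal representation. -/
noncomputable def coeff {m n : ℕ} {a b : List Bool} (ha : a.length = m) (hb : b.length = n) :
    (of k m ⟶ of k n) →ₗ[k] k where
  toFun f := Quotient.lift (s := relSetoid k m n) (fun f => f.coeff a b)
    (fun _ _ h => Rel.coeff h a b ha hb) f
  map_add' f g := by
    induction f using Quotient.inductionOn
    induction g using Quotient.inductionOn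
    rfl
  map_smul' c f := by
    induction f using Quotient.inductionOn
    rfl

theorem coeff_comp {l m n : ℕ} (f : of k l ⟶ of k m) (g : of k m ⟶ of k n) {a b : List Bool}
    (ha : a.length = l) (hb : b.length = n) :
    coeff ha hb (f ≫ g) = ∑ x ∈ (words m).attach,
      coeff ha (mem_words.mp x.2) f * coeff (mem_words.mp x.2) hb g := by
  induction f using Quotient.inductionOn with | _ f
  induction g using Quotient.inductionOn with | _ g
  exact (Finset.sum_attach _ fun x => f.coeff a x * g.coeff x b).symm

theorem coeff_tensor {m n p q : ℕ} (f : of k m ⟶ of k n) (g : of k p ⟶ of k q) {a b : List Bool}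
    (ha : a.length = m + p) (hb : b.length = n + q) :
    coeff ha hb (tensor f g) =
      coeff (a := a.take m) (b := b.take n) (by simp [ha]) (by simp [hb]) f *
        coeff (a := a.drop m) (b := b.drop n) (by simp [ha]) (by simp [hb]) g := by
  induction f using Quotient.inductionOn with | _ f
  induction g using Quotient.inductionOn with | _ g
  rfl

theorem coeff_id {n : ℕ} {a b : List Bool} (ha : a.length = n) (hb : b.length = n) :
    coeff ha hb (𝟙 (of k n)) = if a = b then 1 else 0 := rfl

theorem coeff_cup {a b : List Bool} (ha : a.length = 0) (hb : b.length = 2) :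
    coeff ha hb (cup k) = if b = [true, false] then 1 else 0 := rfl

theorem Pre.coeff_flip {m n : ℕ} (f : Pre k m n) (a b : List Bool) :
    f.flip.coeff a b = f.coeff b a := by
  induction f generalizing a b <;> simp_all [Pre.flip, Pre.coeff, eq_comm, mul_comm]

theorem coeff_bar {m n : ℕ} (f : of k m ⟶ of k n) {a b : List Bool} (ha : a.length = n)
    (hb : b.length = m) : coeff ha hb (bar f) = coeff hb ha f := by
  induction f using Quotient.inductionOn with | _ f
  exact f.coeff_flip a b

theorem Pre.weight_eq {m n : ℕ} (f : Pre k m n) {a b : List Bool} (ha : a.length = m)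
    (hb : b.length = n) (h : f.coeff a b ≠ 0) :
    a.count true + b.count false = b.count true + a.count false := by
  induction f generalizing a b with
  | id n =>
    simp only [Pre.coeff, ne_eq, ite_eq_right_iff, not_forall] at h
    rw [h.1]
  | cup =>
    simp only [Pre.coeff, ne_eq, ite_eq_right_iff, not_forall] at h
    rw [List.length_eq_zero_iff] at ha
    simp [h.1, ha]
  | cap =>
    simp only [Pre.coeff, ne_eq, ite_eq_right_iff, not_forall] at h
    rw [List.length_eq_zero_iff] at hb
    simp [h.1, hb]
  | comp f g ih ih' =>
    obtain ⟨x, hx, h⟩ := Finset.exists_ne_zero_of_sum_ne_zero h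
    rw [mem_words] at hx
    have := ih ha hx (left_ne_zero_of_mul h)
    have := ih' hx hb (right_ne_zero_of_mul h)
    omega
  | @tensor m n p q f g ih ih' =>
    have h₁ := ih (by simp [ha]) (by simp [hb]) (left_ne_zero_of_mul h)
    have h₂ := ih' (by simp [ha]) (by simp [hb]) (right_ne_zero_of_mul h)
    rw [← List.take_append_drop m a, ← List.take_append_drop n b]
    simp only [List.count_append]
    omega
  | zero m n => exact absurd rfl h
  | add f g ih ih' =>
    by_cases hf : f.coeff a b = 0
    · exact ih' ha hb fun hg => h (by rw [Pre.coeff, hf, hg, add_zero])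
    · exact ih ha hb hf
  | smul c f ih => exact ih ha hb (right_ne_zero_of_mul h)

theorem coeff_replicate_eq_zero {l j : ℕ} (f : of k l ⟶ of k j) (hj : j < l) {b : List Bool}
    (hb : b.length = j) : coeff (List.length_replicate (n := l) (a := true)) hb f = 0 := by
  induction f using Quotient.inductionOn with | _ f
  by_contra h
  have h₁ := f.weight_eq List.length_replicate hb h
  have h₂ := b.count_le_length (a := true)
  rw [List.count_replicate_self, List.count_replicate] at h₁
  simp only [beq_iff_eq, Bool.true_eq_false, if_false] at h₁
  omega

theorem id_notMem_throughIdeal {l j : ℕ} (hj : j < l) : 𝟙 (of k l) ∉ throughIdeal k j l l := by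
  intro h
  have hle : throughIdeal k j l l ≤ LinearMap.ker (coeff (k := k)
      (List.length_replicate (n := l) (a := true)) (List.length_replicate (n := l) (a := true))) := by
    rw [throughIdeal, Submodule.span_le]
    rintro _ ⟨i, hi, f, g, rfl⟩
    rw [SetLike.mem_coe, LinearMap.mem_ker, coeff_comp]
    refine Finset.sum_eq_zero fun x _ => ?_
    rw [coeff_replicate_eq_zero f (hi.trans_lt hj), zero_mul]
  have := hle h
  rw [LinearMap.mem_ker, coeff_id, if_pos rfl] at this
  exact one_ne_zero this

theorem coeff_strand {m n : ℕ} (f : of k m ⟶ of k n) {a b : List Bool} {s t : Bool}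
    (ha : a.length = m) (hb : b.length = n) (ha' : (a ++ [s]).length = m + 1)
    (hb' : (b ++ [t]).length = n + 1) :
    coeff ha' hb' (strand f) = if s = t then coeff ha hb f else 0 := by
  subst ha hb
  rw [strand, coeff_tensor, coeff_id]
  simp

theorem coeff_cupLast {l : ℕ} {a b : List Bool} (ha : a.length = l) (hb : b.length = l + 2) :
    coeff ha hb (cupLast k l) = if b = a ++ [true, false] then 1 else 0 := by
  subst ha
  refine (coeff_tensor (p := 0) _ _ _ _).trans ?_
  simp only [List.take_length]
  rw [coeff_id, coeff_cup, ite_zero_mul_ite_zero, mul_one]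
  refine if_congr ⟨fun h => ?_, fun h => by simp [h]⟩ rfl rfl
  rw [← h.2, ← List.take_append_drop a.length b, ← h.1]
  simp

theorem Ballot.coeff_diagram {l m : ℕ} (w : Ballot l m) {b : List Bool} (hb : b.length = m) :
    coeff (List.length_replicate (n := l) (a := true)) hb (w.diagram k) =
      if b = w.word then 1 else 0 := by
  induction w generalizing b with
  | nil =>
    rw [List.length_eq_zero_iff] at hb
    subst hb
    rfl
  | @up l m w ih =>
    obtain ⟨b, t, rfl⟩ := List.eq_nil_or_concat' b |>.resolve_left (by rintro rfl; simp at hb)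
    have hb' : b.length = m := by simpa using hb
    have h := coeff_strand (w.diagram k) (a := List.replicate l true) (s := true) (t := t)
      List.length_replicate hb'
      (by simp) hb
    simp only [← List.replicate_succ'] at h
    rw [diagram, h, ih]
    cases t <;> simp [word]
  | @down l m w ih =>
    obtain ⟨b, t, rfl⟩ := List.eq_nil_or_concat' b |>.resolve_left (by rintro rfl; simp at hb)
    have hb' : b.length = m := by simpa using hb
    have hl : List.replicate (l + 1) true ++ [false] =
      List.replicate l true ++ [true, false] := by simp [List.replicate_succ']
    have h := coeff_strand (w.diagram k) (a := List.replicate (l + 1) true) (s := false) (t := t)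
      List.length_replicate hb'
      (by simp) hb
    rw [diagram, coeff_comp]
    rw [Finset.sum_eq_single ⟨List.replicate (l + 1) true ++ [false], mem_words.mpr (by simp)⟩]
    · rw [coeff_cupLast, if_pos hl, h, ih, one_mul]
      cases t <;> simp [word]
    · intro x _ hx
      rw [coeff_cupLast, if_neg, zero_mul]
      rw [← hl]
      exact fun h => hx (Subtype.ext h)
    · simp

theorem IsCupWord.eq_of_comp_bar {l m : ℕ} {u u' : of k l ⟶ of k m} (hu : IsCupWord u)
    (hu' : IsCupWord u') (h : u ≫ TLZero.bar u' = 𝟙 (of k l)) : u = u' := by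
  obtain ⟨w, rfl⟩ := hu.exists_ballot
  obtain ⟨w', rfl⟩ := hu'.exists_ballot
  have h' := congrArg (coeff (List.length_replicate (n := l) (a := true))
    (List.length_replicate (n := l) (a := true))) h
  rw [coeff_comp, coeff_id, if_pos rfl] at h'
  obtain ⟨x, _, hx⟩ := Finset.exists_ne_zero_of_sum_ne_zero (h'.trans_ne one_ne_zero)
  rw [coeff_bar, w.coeff_diagram, w'.coeff_diagram] at hx
  have h₁ := left_ne_zero_of_mul hx
  have h₂ := right_ne_zero_of_mul hx
  simp only [ne_eq, ite_eq_right_iff, not_forall] at h₁ h₂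
  rw [w.word_injective w' (h₁.1.symm.trans h₂.1)]

/-! ### Straightening words -/

/-- A morphism that is zero or a cap diagram followed by a cup diagram. -/
def IsReduced {m n : ℕ} (f : of k m ⟶ of k n) : Prop :=
  f = 0 ∨ ∃ (j : ℕ) (v : of k m ⟶ of k j) (u : of k j ⟶ of k n),
    IsCapWord v ∧ IsCupWord u ∧ f = v ≫ u

theorem isReduced_zero (m n : ℕ) : IsReduced (0 : of k m ⟶ of k n) := .inl rfl

theorem IsReduced.strand {m n : ℕ} {f : of k m ⟶ of k n} (h : IsReduced f) :
    IsReduced (strand f) := by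
  obtain rfl | ⟨j, v, u, hv, hu, rfl⟩ := h
  · rw [strand_zero]
    exact isReduced_zero _ _
  · exact .inr ⟨_, _, _, hv.strand, hu.strand, strand_comp v u⟩

theorem IsReduced.bar {m n : ℕ} {f : of k m ⟶ of k n} (h : IsReduced f) : IsReduced (bar f) := by
  obtain rfl | ⟨j, v, u, hv, hu, rfl⟩ := h
  · rw [bar_zero]
    exact isReduced_zero _ _
  · exact .inr ⟨_, _, _, hu.bar, hv.bar, bar_comp v u⟩

theorem IsReduced.cap_comp {l m n : ℕ} {v : of k l ⟶ of k m} {f : of k m ⟶ of k n}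
    (hv : IsCapWord v) (h : IsReduced f) : IsReduced (v ≫ f) := by
  obtain rfl | ⟨j, v', u, hv', hu, rfl⟩ := h
  · rw [Limits.comp_zero]
    exact isReduced_zero _ _
  · exact .inr ⟨_, _, _, .comp hv hv', hu, (Category.assoc _ _ _).symm⟩

theorem IsReduced.comp_cup {l m n : ℕ} {u : of k m ⟶ of k n} {f : of k l ⟶ of k m}
    (h : IsReduced f) (hu : IsCupWord u) : IsReduced (f ≫ u) := by
  obtain rfl | ⟨j, v, u', hv, hu', rfl⟩ := h
  · rw [Limits.zero_comp]
    exact isReduced_zero _ _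
  · exact .inr ⟨_, _, _, hv, .comp hu' hu, Category.assoc _ _ _⟩

theorem isReduced_of_isCupWord {m n : ℕ} {u : of k m ⟶ of k n} (hu : IsCupWord u) :
    IsReduced u := .inr ⟨_, _, _, .id m, hu, (Category.id_comp u).symm⟩

theorem isReduced_of_isCapWord {m n : ℕ} {v : of k m ⟶ of k n} (hv : IsCapWord v) :
    IsReduced v := .inr ⟨_, _, _, hv, .id n, (Category.comp_id v).symm⟩

theorem Ballot.isReduced_comp_capLast {j n : ℕ} (w : Ballot j (n + 2)) :
    IsReduced (w.diagram k ≫ capLast k n) := by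
  cases w with
  | up w =>
    cases w with
    | up w =>
      rw [diagram, diagram, strand_strand_comp_capLast]
      exact .cap_comp (isCapWord_capLast _) (isReduced_of_isCupWord w.isCupWord)
    | down w =>
      rw [diagram, diagram, strand_comp, Category.assoc, strand_strand_comp_capLast,
        ← Category.assoc, strand_cupLast_comp_capLast, Limits.zero_comp]
      exact isReduced_zero _ _
  | down w =>
    cases w with
    | up w =>
      rw [diagram, diagram, Category.assoc, strand_strand_comp_capLast, ← Category.assoc,
        cupLast_comp_capLast, Category.id_comp]
      exact isReduced_of_isCupWord w.isCupWord
    | down w =>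
      rw [diagram, diagram, strand_comp, Category.assoc, Category.assoc,
        strand_strand_comp_capLast, ← Category.assoc (strand _), strand_cupLast_comp_capLast,
        Limits.zero_comp, Limits.comp_zero]
      exact isReduced_zero _ _

theorem IsReduced.comp_capLast {m n : ℕ} {f : of k m ⟶ of k (n + 2)} (h : IsReduced f) :
    IsReduced (f ≫ capLast k n) := by
  obtain rfl | ⟨j, v, u, hv, hu, rfl⟩ := h
  · rw [Limits.zero_comp]
    exact isReduced_zero _ _
  · obtain ⟨w, rfl⟩ := hu.exists_ballot
    rw [Category.assoc]
    exact .cap_comp hv w.isReduced_comp_capLast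

theorem IsReduced.cupLast_comp {m n : ℕ} {f : of k (m + 2) ⟶ of k n} (h : IsReduced f) :
    IsReduced (cupLast k m ≫ f) := by
  have := h.bar.comp_capLast.bar
  rwa [bar_comp, bar_bar, bar_capLast] at this

theorem Ballot.isReduced_comp_bar {l l' n : ℕ} (w : Ballot l n) (w' : Ballot l' n) :
    IsReduced (w.diagram k ≫ TLZero.bar (w'.diagram k)) := by
  induction n generalizing l l' with
  | zero =>
    cases w
    cases w'
    rw [diagram, bar_id, Category.comp_id]
    exact isReduced_of_isCupWord (.id 0)
  | succ n ih =>
    cases w with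
    | up w =>
      cases w' with
      | up w' =>
        rw [diagram, diagram, bar_strand, ← strand_comp]
        exact (ih w w').strand
      | down w' =>
        rw [diagram, diagram, bar_comp, bar_strand, bar_cupLast, ← Category.assoc, ← strand_comp]
        exact (ih w w').strand.comp_capLast
    | down w =>
      cases w' with
      | up w' =>
        rw [diagram, diagram, bar_strand, Category.assoc, ← strand_comp]
        exact (ih w w').strand.cupLast_comp
      | down w' =>
        rw [diagram, diagram, bar_comp, bar_strand, bar_cupLast, Category.assoc,
          ← Category.assoc (strand _), ← strand_comp]
        exact (ih w w').strand.comp_capLast.cupLast_comp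

theorem isReduced_cup_comp_cap {l m n : ℕ} {u : of k l ⟶ of k m} {v : of k m ⟶ of k n}
    (hu : IsCupWord u) (hv : IsCapWord v) : IsReduced (u ≫ v) := by
  obtain ⟨w, rfl⟩ := hu.exists_ballot
  obtain ⟨w', rfl⟩ := hv.exists_ballot
  exact w.isReduced_comp_bar w'

theorem IsReduced.comp {l m n : ℕ} {f : of k l ⟶ of k m} {g : of k m ⟶ of k n}
    (hf : IsReduced f) (hg : IsReduced g) : IsReduced (f ≫ g) := by
  obtain rfl | ⟨j, v, u, hv, hu, rfl⟩ := hf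
  · rw [Limits.zero_comp]
    exact isReduced_zero _ _
  · obtain rfl | ⟨j', v', u', hv', hu', rfl⟩ := hg
    · rw [Limits.comp_zero]
      exact isReduced_zero _ _
    · rw [Category.assoc, ← Category.assoc u]
      exact .cap_comp hv ((isReduced_cup_comp_cap hu hv').comp_cup hu')

theorem IsReduced.tensor {m n p q : ℕ} {f : of k m ⟶ of k n} {g : of k p ⟶ of k q}
    (hf : IsReduced f) (hg : IsReduced g) : IsReduced (tensor f g) := by
  obtain rfl | ⟨j, v, u, hv, hu, rfl⟩ := hf
  · exact .inl (zero_tensor _)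
  · obtain rfl | ⟨j', v', u', hv', hu', rfl⟩ := hg
    · exact .inl (tensor_zero _)
    · exact .inr ⟨_, _, _, .tensor hv hv', .tensor hu hu', tensor_comp _ _ _ _⟩

theorem IsWord.isReduced {m n : ℕ} {f : of k m ⟶ of k n} (h : IsWord f) : IsReduced f := by
  induction h with
  | id n => exact isReduced_of_isCupWord (.id n)
  | cup => exact isReduced_of_isCupWord .cup
  | cap => exact isReduced_of_isCapWord .cap
  | comp _ _ ih ih' => exact ih.comp ih'
  | tensor _ _ ih ih' => exact ih.tensor ih'

/-! ### Through-strands and uniqueness -/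

theorem id_ne_zero (n : ℕ) : 𝟙 (of k n) ≠ 0 := by
  intro h
  have h' := congrArg (coeff (List.length_replicate (n := n) (a := true))
    (List.length_replicate (n := n) (a := true))) h
  rw [coeff_id, if_pos rfl, map_zero] at h'
  exact one_ne_zero h'

theorem IsCapWord.bar_comp {m n : ℕ} {v : of k m ⟶ of k n} (h : IsCapWord v) :
    TLZero.bar v ≫ v = 𝟙 _ := by
  have := h.bar.comp_bar
  rwa [bar_bar] at this

theorem IsCupWord.isCupDiagram {m n : ℕ} {u : of k m ⟶ of k n} (h : IsCupWord u) :
    IsCupDiagram u := by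
  refine ⟨h, ?_⟩
  rintro rfl
  have := h.comp_bar
  rw [Limits.zero_comp] at this
  exact id_ne_zero m this.symm

theorem IsCapWord.isCapDiagram {m n : ℕ} {v : of k m ⟶ of k n} (h : IsCapWord v) :
    IsCapDiagram v := by
  refine ⟨h, ?_⟩
  rintro rfl
  have := h.bar_comp
  rw [Limits.comp_zero] at this
  exact id_ne_zero n this.symm

theorem comp_mem_throughIdeal {l m n m' n' : ℕ} {f : of k m ⟶ of k n}
    (hf : f ∈ throughIdeal k l m n) (g : of k m' ⟶ of k m) (h : of k n ⟶ of k n') :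
    g ≫ f ≫ h ∈ throughIdeal k l m' n' := by
  have hle : throughIdeal k l m n ≤ (throughIdeal k l m' n').comap
      (Linear.leftComp k (of k n') g ∘ₗ Linear.rightComp k (of k m) h) := by
    rw [throughIdeal, Submodule.span_le]
    rintro _ ⟨j, hj, a, b, rfl⟩
    exact Submodule.subset_span ⟨j, hj, g ≫ a, b ≫ h, by simp⟩
  exact hle hf

theorem cap_comp_cup_notMem {j l m n : ℕ} {v : of k m ⟶ of k l} {u : of k l ⟶ of k n}
    (hv : IsCapWord v) (hu : IsCupWord u) (hj : j < l) : v ≫ u ∉ throughIdeal k j m n := by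
  intro h
  have h' := comp_mem_throughIdeal h (bar v) (bar u)
  rw [Category.assoc, hu.comp_bar, Category.comp_id, hv.bar_comp] at h'
  exact id_notMem_throughIdeal hj h'

theorem through_cap_comp_cup {l m n : ℕ} {v : of k m ⟶ of k l} {u : of k l ⟶ of k n}
    (hv : IsCapWord v) (hu : IsCupWord u) : through (v ≫ u) = l := by
  refine le_antisymm (Nat.sInf_le (Submodule.subset_span ⟨l, le_rfl, v, u, rfl⟩)) ?_
  refine le_csInf ⟨l, Submodule.subset_span ⟨l, le_rfl, v, u, rfl⟩⟩ fun j hj => ?_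
  exact not_lt.mp fun hlt => cap_comp_cup_notMem hv hu hlt hj

theorem cap_comp_cup_ne_zero {l m n : ℕ} {v : of k m ⟶ of k l} {u : of k l ⟶ of k n}
    (hv : IsCapWord v) (hu : IsCupWord u) : v ≫ u ≠ 0 := by
  intro h
  have h' : bar v ≫ (v ≫ u) ≫ bar u = 0 := by rw [h, Limits.zero_comp, Limits.comp_zero]
  rw [Category.assoc, hu.comp_bar, Category.comp_id, hv.bar_comp] at h'
  exact id_ne_zero l h'

theorem cap_comp_cup_injective {l m n : ℕ} {v v' : of k m ⟶ of k l} {u u' : of k l ⟶ of k n}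
    (hv : IsCapWord v) (hu : IsCupWord u) (hv' : IsCapWord v') (hu' : IsCupWord u')
    (h : v ≫ u = v' ≫ u') : u = u' ∧ v = v' := by
  have h₁ : u = (u ≫ bar u') ≫ u' := by
    have h₂ : u ≫ bar u' = bar v ≫ v' := by
      rw [← Category.id_comp u, ← hv.bar_comp, Category.assoc, Category.assoc,
        ← Category.assoc v, h, Category.assoc, hu'.comp_bar, Category.comp_id]
    rw [h₂, Category.assoc, ← h, ← Category.assoc, hv.bar_comp, Category.id_comp]
  have h₂ : u ≫ bar u' = 𝟙 _ := by
    obtain h₀ | ⟨j, v₁, u₁, hv₁, hu₁, h₀⟩ := isReduced_cup_comp_cap hu hu'.bar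
    · rw [h₀, Limits.zero_comp] at h₁
      exact absurd h₁ hu.isCupDiagram.2
    · obtain rfl | hj := hv₁.le.eq_or_lt
      · rw [h₀, hv₁.eq_id, hu₁.eq_id, Category.comp_id]
      · refine absurd ?_ (cap_comp_cup_notMem (.id l) hu hj)
        rw [Category.id_comp, h₁, h₀]
        exact Submodule.subset_span ⟨j, le_rfl, v₁, u₁ ≫ u', (Category.assoc _ _ _).symm⟩
  obtain rfl := hu.eq_of_comp_bar hu' h₂
  refine ⟨rfl, ?_⟩
  rw [← Category.comp_id v, ← hu.comp_bar, ← Category.assoc, h, Category.assoc, hu.comp_bar,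
    Category.comp_id]

theorem isCupCap_iff {m n l : ℕ} {x : of k m ⟶ of k n} {u : of k l ⟶ of k n}
    {v : of k m ⟶ of k l} : IsCupCap x u v ↔ IsCupWord u ∧ IsCapWord v ∧ x = v ≫ u :=
  ⟨fun h => ⟨h.1.1, h.2.1.1, h.2.2⟩, fun h => ⟨h.1.isCupDiagram, h.2.1.isCapDiagram, h.2.2⟩⟩

theorem IsCupCap.unique {m n l l' : ℕ} {x : of k m ⟶ of k n} {u : of k l ⟶ of k n}
    {v : of k m ⟶ of k l} {u' : of k l' ⟶ of k n} {v' : of k m ⟶ of k l'}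
    (h : IsCupCap x u v) (h' : IsCupCap x u' v') :
    (⟨l, u, v⟩ : Σ l : ℕ, (of k l ⟶ of k n) × (of k m ⟶ of k l)) = ⟨l', u', v'⟩ := by
  obtain ⟨hu, hv, rfl⟩ := isCupCap_iff.mp h
  obtain ⟨hu', hv', hx⟩ := isCupCap_iff.mp h'
  obtain rfl : l = l' := by
    rw [← through_cap_comp_cup hv hu, hx, through_cap_comp_cup hv' hu']
  obtain ⟨rfl, rfl⟩ := cap_comp_cup_injective hv hu hv' hu' hx
  rfl

theorem IsTLDiagram.exists_isCupCap {m n : ℕ} {x : of k m ⟶ of k n} (h : IsTLDiagram x) :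
    ∃ (l : ℕ) (u : of k l ⟶ of k n) (v : of k m ⟶ of k l), IsCupCap x u v := by
  obtain ⟨j, v, u, hv, hu, h'⟩ := h.1.isReduced.resolve_left h.2
  exact ⟨j, u, v, isCupCap_iff.mpr ⟨hu, hv, h'⟩⟩

theorem isTLDiagram_cap_comp_cup {l m n : ℕ} {v : of k m ⟶ of k l} {u : of k l ⟶ of k n}
    (hv : IsCapWord v) (hu : IsCupWord u) : IsTLDiagram (v ≫ u) :=
  ⟨.comp hv.isWord hu.isWord, cap_comp_cup_ne_zero hv hu⟩

theorem maxSummand_cap_comp_cup {l m n : ℕ} {v : of k m ⟶ of k l} {u : of k l ⟶ of k n}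
    (hv : IsCapWord v) (hu : IsCupWord u) :
    maxSummand (v ≫ u) = v ≫ jonesWenzl k l ≫ u := by
  have hx : IsCupCap (v ≫ u) u v := isCupCap_iff.mpr ⟨hu, hv, rfl⟩
  have h : ∃ p : Σ l : ℕ, (of k l ⟶ of k n) × (of k m ⟶ of k l),
      IsCupCap (v ≫ u) p.2.1 p.2.2 := ⟨⟨l, u, v⟩, hx⟩
  rw [maxSummand, dif_pos h]
  have := hx.unique h.choose_spec
  generalize h.choose = p at this
  obtain rfl : _ = p := this
  rfl

/-! ### The Jones–Wenzl projectors -/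

theorem capAt_congr (n : ℕ) {I J : Finset ℕ} (h : ∀ i, 1 ≤ i → i < n → (i ∈ I ↔ i ∈ J)) :
    capAt k n I = capAt k n J := by
  induction n using Nat.strong_induction_on with
  | _ n ih =>
    match n with
    | 0 => rfl
    | 1 => rfl
    | n + 2 =>
      have h₁ := ih n (by omega) fun i h₁ h₂ => h i h₁ (by omega)
      have h₂ := ih (n + 1) (by omega) fun i h₁ h₂ => h i h₁ (by omega)
      rw [capAt, capAt, h₁, h₂, if_congr (h (n + 1) (by omega) (by omega)) rfl rfl]

theorem capAt_of_mem {n : ℕ} {I : Finset ℕ} (h : n + 1 ∈ I) :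
    capAt k (n + 2) I = ⟨(capAt k n I).1 + 0, tensor (capAt k n I).2 (cap k)⟩ := by
  rw [capAt, if_pos h]

theorem capAt_of_notMem {n : ℕ} {I : Finset ℕ} (h : n + 1 ∉ I) :
    capAt k (n + 2) I =
      ⟨(capAt k (n + 1) I).1 + 1, strand (capAt k (n + 1) I).2⟩ := by
  rw [capAt, if_neg h]
  rfl

/-- The summand of the Jones–Wenzl projector indexed by `I`. -/
noncomputable def jonesWenzlTerm (k : Type u) [Field k] (n : ℕ) (I : Finset ℕ) :
    of k n ⟶ of k n :=
  (-1 : k) ^ I.card • ((capAt k n I).2 ≫ bar (capAt k n I).2)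

theorem jonesWenzlTerm_of_notMem {n : ℕ} {I : Finset ℕ} (h : n + 1 ∉ I) :
    jonesWenzlTerm k (n + 2) I = strand (jonesWenzlTerm k (n + 1) I) := by
  rw [jonesWenzlTerm, capAt_of_notMem h, bar_strand, ← strand_comp]
  exact (smul_tensor _ _ _).symm

theorem jonesWenzlTerm_insert {n : ℕ} {I : Finset ℕ} (h : n + 1 ∉ I) :
    jonesWenzlTerm k (n + 2) (insert (n + 1) I) =
      -tensor (jonesWenzlTerm k n I) (cap k ≫ cup k) := by
  rw [jonesWenzlTerm, capAt_of_mem (Finset.mem_insert_self _ _)]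
  have hc : capAt k n (insert (n + 1) I) = capAt k n I := by
    refine capAt_congr n fun i _ hi => ?_
    rw [Finset.mem_insert, or_iff_right (by omega)]
  rw [hc, Finset.card_insert_of_notMem h, pow_succ, mul_neg_one, neg_smul, jonesWenzlTerm,
    smul_tensor]
  refine congrArg _ (congrArg _ ?_)
  change tensor (capAt k n I).2 (cap k) ≫ bar (tensor (capAt k n I).2 (cap k)) = _
  rw [bar_tensor, ← tensor_comp]
  rfl

theorem isApt_succ_succ_iff {n : ℕ} {I : Finset ℕ} (h : n + 1 ∉ I) :
    IsApt (n + 2) I ↔ IsApt (n + 1) I := by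
  constructor
  · rintro ⟨h₁, h₂, h₃⟩
    refine ⟨fun i hi => ?_, h, h₃⟩
    have := Finset.mem_Icc.mp (h₁ hi)
    have : i ≠ n + 2 := fun e => h₂ (e ▸ hi)
    exact Finset.mem_Icc.mpr (by omega)
  · rintro ⟨h₁, h₂, h₃⟩
    refine ⟨fun i hi => ?_, fun hi => ?_, h₃⟩
    · have := Finset.mem_Icc.mp (h₁ hi)
      exact Finset.mem_Icc.mpr (by omega)
    · have := Finset.mem_Icc.mp (h₁ hi)
      omega

theorem isApt_insert_iff {n : ℕ} {I : Finset ℕ} (h : n + 1 ∉ I) :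
    IsApt (n + 2) (insert (n + 1) I) ↔ IsApt n I := by
  constructor
  · rintro ⟨h₁, h₂, h₃⟩
    have hn : n ∉ I := fun hn => (h₃ (n + 1) (by simp)).1 (by simp [hn])
    refine ⟨fun i hi => ?_, hn, fun i hi => ?_⟩
    · have := Finset.mem_Icc.mp (h₁ (Finset.mem_insert_of_mem hi))
      have : i ≠ n + 1 := fun e => h (e ▸ hi)
      have : i ≠ n + 2 := fun e => h₂ (e ▸ Finset.mem_insert_of_mem hi)
      exact Finset.mem_Icc.mpr (by omega)
    · have := h₃ i (Finset.mem_insert_of_mem hi)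
      simp only [Finset.mem_insert, not_or] at this
      exact ⟨this.1.2, this.2.2⟩
  · rintro ⟨h₁, h₂, h₃⟩
    have hI : ∀ i ∈ I, 1 ≤ i ∧ i < n := fun i hi => by
      have := Finset.mem_Icc.mp (h₁ hi)
      have : i ≠ n := fun e => h₂ (e ▸ hi)
      omega
    refine ⟨fun i hi => ?_, fun hi => ?_, fun i hi => ?_⟩
    · obtain rfl | hi := Finset.mem_insert.mp hi
      · exact Finset.mem_Icc.mpr (by omega)
      · have := hI i hi
        exact Finset.mem_Icc.mpr (by omega)
    · obtain hi | hi := Finset.mem_insert.mp hi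
      · omega
      · have := hI _ hi
        omega
    · simp only [Finset.mem_insert, not_or]
      obtain rfl | hi := Finset.mem_insert.mp hi
      · refine ⟨⟨by omega, h₂⟩, ⟨by omega, fun hi => ?_⟩⟩
        have := hI _ hi
        omega
      · have := hI i hi
        exact ⟨⟨by omega, (h₃ i hi).1⟩, ⟨by omega, (h₃ i hi).2⟩⟩

open Classical in
/-- The apt subsets of `{1, …, n}`. -/
noncomputable def aptSets (n : ℕ) : Finset (Finset ℕ) :=
  (Finset.Icc 1 n).powerset.filter (IsApt n)

theorem mem_aptSets {n : ℕ} {I : Finset ℕ} : I ∈ aptSets n ↔ IsApt n I := by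
  simp only [aptSets, Finset.mem_filter, Finset.mem_powerset]
  exact and_iff_right_of_imp fun h => h.1

theorem IsApt.notMem {n i : ℕ} {I : Finset ℕ} (h : IsApt n I) (hi : n ≤ i) : i ∉ I := by
  intro hI
  have := Finset.mem_Icc.mp (h.1 hI)
  obtain rfl : i = n := by omega
  exact h.2.1 hI

theorem jonesWenzl_eq (n : ℕ) :
    jonesWenzl k n = ∑ I ∈ aptSets n, jonesWenzlTerm k n I := rfl

theorem jonesWenzl_of_le_one {n : ℕ} (hn : n ≤ 1) : jonesWenzl k n = 𝟙 (of k n) := by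
  have h : aptSets n = {∅} := by
    ext I
    rw [mem_aptSets, Finset.mem_singleton]
    constructor
    · intro hI
      refine Finset.eq_empty_of_forall_notMem fun i hi => hI.notMem ?_ hi
      have := Finset.mem_Icc.mp (hI.1 hi)
      omega
    · rintro rfl
      exact ⟨by simp, by simp, by simp⟩
  rw [jonesWenzl_eq, h, Finset.sum_singleton, jonesWenzlTerm, Finset.card_empty, pow_zero, one_smul]
  interval_cases n <;> exact Category.comp_id _

theorem jonesWenzl_succ_succ_eq (n : ℕ) :
    jonesWenzl k (n + 2) =
      strand (jonesWenzl k (n + 1)) - tensor (jonesWenzl k n) (cap k ≫ cup k) := by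
  have h : aptSets (n + 2) = aptSets (n + 1) ∪ (aptSets n).image (insert (n + 1)) := by
    ext I
    simp only [Finset.mem_union, Finset.mem_image, mem_aptSets]
    by_cases hI : n + 1 ∈ I
    · rw [or_iff_right fun h : IsApt (n + 1) I => h.2.1 hI]
      constructor
      · intro h
        refine ⟨I.erase (n + 1), ?_, Finset.insert_erase hI⟩
        rwa [← isApt_insert_iff (Finset.notMem_erase _ _), Finset.insert_erase hI]
      · rintro ⟨J, hJ, rfl⟩
        exact (isApt_insert_iff (hJ.notMem n.le_succ)).mpr hJ
    · rw [isApt_succ_succ_iff hI, or_iff_left]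
      rintro ⟨J, _, rfl⟩
      exact hI (Finset.mem_insert_self _ _)
  rw [jonesWenzl_eq, h, Finset.sum_union, Finset.sum_image]
  · have h₁ : strand (jonesWenzl k (n + 1)) =
        ∑ I ∈ aptSets (n + 1), strand (jonesWenzlTerm k (n + 1) I) :=
      map_sum (tensorRight (n + 1) (n + 1) (𝟙 (of k 1))) _ _
    have h₂ : tensor (jonesWenzl k n) (cap k ≫ cup k) =
        ∑ I ∈ aptSets n, tensor (jonesWenzlTerm k n I) (cap k ≫ cup k) :=
      map_sum (tensorRight n n (cap k ≫ cup k)) _ _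
    rw [h₁, h₂, sub_eq_add_neg, ← Finset.sum_neg_distrib]
    congr 1
    · exact Finset.sum_congr rfl fun I hI =>
        jonesWenzlTerm_of_notMem ((mem_aptSets.mp hI).notMem le_rfl)
    · exact Finset.sum_congr rfl fun I hI =>
        jonesWenzlTerm_insert ((mem_aptSets.mp hI).notMem n.le_succ)
  · intro I hI J hJ hIJ
    have hI' := (mem_aptSets.mp hI).notMem n.le_succ
    have hJ' := (mem_aptSets.mp hJ).notMem n.le_succ
    rw [← Finset.erase_insert hI', ← Finset.erase_insert hJ', hIJ]
  · rw [Finset.disjoint_left]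
    intro I hI hI'
    obtain ⟨J, _, rfl⟩ := Finset.mem_image.mp hI'
    exact (mem_aptSets.mp hI).2.1 (Finset.mem_insert_self _ _)

theorem tensor_cap_comp_cup {m n : ℕ} (f : of k m ⟶ of k n) :
    tensor f (cap k ≫ cup k) = strand (strand f) ≫ capLast k n ≫ cupLast k n := by
  have h := tensor_comp (𝟙 _) f (cap k) (cup k)
  have h' : tensor (𝟙 (of k m)) (cap k) = capLast k m := rfl
  rw [Category.id_comp, tensor_cup, h'] at h
  refine h.trans ?_
  rw [← Category.assoc (strand _), strand_strand_comp_capLast, Category.assoc]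

theorem jonesWenzl_succ_succ (n : ℕ) :
    jonesWenzl k (n + 2) = strand (jonesWenzl k (n + 1)) -
      strand (strand (jonesWenzl k n)) ≫ capLast k n ≫ cupLast k n := by
  rw [jonesWenzl_succ_succ_eq, tensor_cap_comp_cup]

theorem bar_jonesWenzl (n : ℕ) : bar (jonesWenzl k n) = jonesWenzl k n := by
  induction n using Nat.strong_induction_on with
  | _ n ih =>
    match n with
    | 0 => rw [jonesWenzl_of_le_one (by omega), bar_id]
    | 1 => rw [jonesWenzl_of_le_one (by omega), bar_id]
    | n + 2 =>
      rw [jonesWenzl_succ_succ_eq, bar_sub, bar_strand, bar_tensor, ih n (by omega),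
        ih (n + 1) (by omega), bar_comp]
      rfl

theorem jonesWenzl_comp_diagram {j n : ℕ} (w : Ballot j n) (hj : j ≠ n) :
    jonesWenzl k n ≫ bar (w.diagram k) = 0 := by
  induction n using Nat.strong_induction_on generalizing j with
  | _ n ih =>
    match n, ih, w, hj with
    | 0, _, .nil, hj => exact absurd rfl hj
    | 1, _, .up .nil, hj => exact absurd rfl hj
    | n + 2, ih, .up (.up w), hj =>
      have h₁ := ih (n + 1) (by omega) (.up w) (by omega)
      have h₂ := ih n (by omega) w (by omega)
      rw [Ballot.diagram, bar_strand] at h₁ ⊢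
      rw [Ballot.diagram, bar_strand, jonesWenzl_succ_succ, Preadditive.sub_comp, ← strand_comp, h₁,
        strand_zero, Category.assoc, Category.assoc, cupLast_comp_strand_strand,
        ← Category.assoc (capLast k n), ← strand_strand_comp_capLast, ← Category.assoc,
        ← Category.assoc, ← strand_comp, ← strand_comp, h₂, strand_zero, strand_zero,
        Limits.zero_comp, Limits.zero_comp, sub_zero]
    | n + 2, ih, .up (.down w), hj =>
      have h₁ := ih (n + 1) (by omega) (.down w) (by omega)
      rw [Ballot.diagram, bar_comp, bar_strand, bar_cupLast] at h₁
      rw [Ballot.diagram, bar_strand, Ballot.diagram, bar_comp, bar_strand, bar_cupLast,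
        jonesWenzl_succ_succ, Preadditive.sub_comp, ← strand_comp, h₁, strand_zero, Category.assoc,
        Category.assoc, strand_comp, ← Category.assoc (cupLast k n), cupLast_comp_strand_strand,
        Category.assoc, cupLast_comp_strand_capLast, Limits.comp_zero, Limits.comp_zero,
        Limits.comp_zero, sub_zero]
    | n + 2, ih, .down (.up w), hj =>
      rw [Ballot.diagram, bar_comp, bar_strand, bar_cupLast, Ballot.diagram, bar_strand,
        strand_strand_comp_capLast, jonesWenzl_succ_succ, Preadditive.sub_comp, Category.assoc,
        Category.assoc, ← Category.assoc (cupLast k n), cupLast_comp_capLast, Category.id_comp]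
      match n, ih with
      | 0, _ =>
        rw [jonesWenzl_of_le_one (by omega), jonesWenzl_of_le_one (by omega), strand_id, strand_id,
          strand_id, Category.id_comp]
        exact sub_self _
      | n + 1, ih =>
        rw [jonesWenzl_succ_succ n, strand_sub, Preadditive.sub_comp, strand_comp, strand_comp,
          Category.assoc, Category.assoc, ← Category.assoc (strand (cupLast k n)),
          strand_cupLast_comp_capLast, Limits.zero_comp, Limits.comp_zero, Limits.comp_zero,
          sub_zero, sub_self]
    | n + 2, ih, .down (.down w), hj =>
      have h₁ := ih (n + 1) (by omega) (.down w) (by have := w.le; omega)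
      rw [Ballot.diagram, bar_comp, bar_strand, bar_cupLast] at h₁
      rw [Ballot.diagram, bar_comp, bar_strand, bar_cupLast, Ballot.diagram, bar_comp, bar_strand,
        bar_cupLast, jonesWenzl_succ_succ, Preadditive.sub_comp, ← Category.assoc (strand _),
        ← strand_comp, h₁, strand_zero, Limits.zero_comp, strand_comp]
      simp only [Category.assoc]
      rw [← Category.assoc (cupLast k n), cupLast_comp_strand_strand, Category.assoc,
        ← Category.assoc (cupLast k _) (strand _), cupLast_comp_strand_capLast, Limits.zero_comp,
        Limits.comp_zero, Limits.comp_zero, Limits.comp_zero, sub_zero]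

theorem jonesWenzl_comp_cap {j n : ℕ} {v : of k n ⟶ of k j} (hv : IsCapWord v) (hj : j ≠ n) :
    jonesWenzl k n ≫ v = 0 := by
  obtain ⟨w, rfl⟩ := hv.exists_ballot
  exact jonesWenzl_comp_diagram w hj

theorem cup_comp_jonesWenzl {j n : ℕ} {u : of k j ⟶ of k n} (hu : IsCupWord u) (hj : j ≠ n) :
    u ≫ jonesWenzl k n = 0 := by
  rw [← bar_bar (u ≫ jonesWenzl k n), bar_comp, bar_jonesWenzl, jonesWenzl_comp_cap hu.bar hj,
    bar_zero]

/-- The span of the composites of a cap diagram and a cup diagram with fewer than `c`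
through-strands. -/
def lowerSpan (k : Type u) [Field k] (m n c : ℕ) : Submodule k (of k m ⟶ of k n) :=
  Submodule.span k {f | ∃ j < c, ∃ (v : of k m ⟶ of k j) (u : of k j ⟶ of k n),
    IsCapWord v ∧ IsCupWord u ∧ v ≫ u = f}

theorem lowerSpan_mono {m n c d : ℕ} (h : c ≤ d) : lowerSpan k m n c ≤ lowerSpan k m n d :=
  Submodule.span_mono fun _ ⟨j, hj, v, u, hf⟩ => ⟨j, hj.trans_le h, v, u, hf⟩

theorem cap_comp_cup_mem_lowerSpan {m n j c : ℕ} {v : of k m ⟶ of k j} {u : of k j ⟶ of k n}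
    (hv : IsCapWord v) (hu : IsCupWord u) (hj : j < c) : v ≫ u ∈ lowerSpan k m n c :=
  Submodule.subset_span ⟨j, hj, v, u, hv, hu, rfl⟩

theorem strand_mem_lowerSpan {m n c : ℕ} {f : of k m ⟶ of k n} (hf : f ∈ lowerSpan k m n c) :
    strand f ∈ lowerSpan k (m + 1) (n + 1) (c + 1) := by
  have hle : lowerSpan k m n c ≤ (lowerSpan k (m + 1) (n + 1) (c + 1)).comap
      (tensorRight m n (𝟙 (of k 1))) := by
    rw [lowerSpan, Submodule.span_le]
    rintro _ ⟨j, hj, v, u, hv, hu, rfl⟩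
    refine Submodule.subset_span ⟨j + 1, by omega, _, _, hv.strand, hu.strand, ?_⟩
    exact (strand_comp v u).symm
  exact hle hf

theorem tensor_cap_cup_mem_lowerSpan {m n c : ℕ} {f : of k m ⟶ of k n}
    (hf : f ∈ lowerSpan k m n c) :
    tensor f (cap k ≫ cup k) ∈ lowerSpan k (m + 2) (n + 2) c := by
  have hle : lowerSpan k m n c ≤ (lowerSpan k (m + 2) (n + 2) c).comap
      (tensorRight m n (cap k ≫ cup k)) := by
    rw [lowerSpan, Submodule.span_le]
    rintro _ ⟨j, hj, v, u, hv, hu, rfl⟩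
    refine Submodule.subset_span ⟨j, hj, tensor v (cap k), tensor u (cup k), .tensor hv .cap,
      .tensor hu .cup, ?_⟩
    exact (tensor_comp v u (cap k) (cup k)).symm
  exact hle hf

theorem jonesWenzl_sub_id_mem (n : ℕ) : jonesWenzl k n - 𝟙 (of k n) ∈ lowerSpan k n n n := by
  induction n using Nat.strong_induction_on with
  | _ n ih =>
    match n with
    | 0 => rw [jonesWenzl_of_le_one (by omega), sub_self]; exact zero_mem _
    | 1 => rw [jonesWenzl_of_le_one (by omega), sub_self]; exact zero_mem _
    | n + 2 =>
      have h₁ := strand_mem_lowerSpan (ih (n + 1) (by omega))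
      have h₂ : jonesWenzl k n ∈ lowerSpan k n n (n + 2) := by
        rw [← sub_add_cancel (jonesWenzl k n) (𝟙 (of k n))]
        refine add_mem (lowerSpan_mono (by omega) (ih n (by omega))) ?_
        rw [← Category.comp_id (𝟙 (of k n))]
        exact cap_comp_cup_mem_lowerSpan (.id n) (.id n) (by omega)
      rw [strand_sub, strand_id] at h₁
      rw [jonesWenzl_succ_succ_eq, sub_right_comm]
      exact sub_mem h₁ (tensor_cap_cup_mem_lowerSpan h₂)

theorem jonesWenzl_comp_self (n : ℕ) : jonesWenzl k n ≫ jonesWenzl k n = jonesWenzl k n := by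
  have hle : lowerSpan k n n n ≤ LinearMap.ker (Linear.leftComp k (of k n) (jonesWenzl k n)) := by
    rw [lowerSpan, Submodule.span_le]
    rintro _ ⟨j, hj, v, u, hv, hu, rfl⟩
    rw [SetLike.mem_coe, LinearMap.mem_ker, Linear.leftComp_apply, ← Category.assoc,
      jonesWenzl_comp_cap hv hj.ne, Limits.zero_comp]
  have h := hle (jonesWenzl_sub_id_mem n)
  rwa [LinearMap.mem_ker, Linear.leftComp_apply, Preadditive.comp_sub, Category.comp_id,
    sub_eq_zero] at h

theorem jonesWenzl_ne_zero (n : ℕ) : jonesWenzl k n ≠ 0 := by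
  intro h
  have hmem := jonesWenzl_sub_id_mem (k := k) n
  rw [h, zero_sub, neg_mem_iff] at hmem
  cases n with
  | zero => exact id_ne_zero 0 ((jonesWenzl_of_le_one (by omega)).symm.trans h)
  | succ n =>
    refine id_notMem_throughIdeal (k := k) n.lt_succ_self (Submodule.span_mono ?_ hmem)
    rintro _ ⟨j, hj, v, u, _, _, rfl⟩
    exact ⟨j, by omega, v, u, rfl⟩

theorem jonesWenzl_sandwich_self {l n : ℕ} {u : of k l ⟶ of k n} (hu : IsCupWord u) :
    jonesWenzl k l ≫ u ≫ bar u ≫ jonesWenzl k l = jonesWenzl k l := by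
  rw [← Category.assoc u, hu.comp_bar, Category.id_comp, jonesWenzl_comp_self]

theorem jonesWenzl_sandwich_eq_zero {l l' n : ℕ} {u : of k l ⟶ of k n} {v : of k n ⟶ of k l'}
    (hu : IsCupWord u) (hv : IsCapWord v)
    (h : (⟨l, u⟩ : Σ l, (of k l ⟶ of k n)) ≠ ⟨l', bar v⟩) :
    jonesWenzl k l ≫ u ≫ v ≫ jonesWenzl k l' = 0 := by
  rw [← Category.assoc u]
  obtain h₀ | ⟨j, v₁, u₁, hv₁, hu₁, h₀⟩ := isReduced_cup_comp_cap hu hv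
  · rw [h₀, Limits.zero_comp, Limits.comp_zero]
  rw [h₀]
  by_cases hj : j = l
  · subst hj
    by_cases hj' : j = l'
    · subst hj'
      refine absurd ?_ h
      rw [hv₁.eq_id, hu₁.eq_id, Category.comp_id] at h₀
      rw [← bar_bar v] at h₀
      rw [hu.eq_of_comp_bar hv.bar h₀]
    · rw [Category.assoc, cup_comp_jonesWenzl hu₁ hj', Limits.comp_zero, Limits.comp_zero]
  · rw [Category.assoc, ← Category.assoc, jonesWenzl_comp_cap hv₁ hj, Limits.zero_comp]

/-! ### The max-summand basis -/

theorem maxSummand_comp_maxSummand {l l' m n p : ℕ} {u : of k l ⟶ of k n} {v : of k m ⟶ of k l}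
    {u' : of k l' ⟶ of k p} {v' : of k n ⟶ of k l'} (hu : IsCupWord u) (hv : IsCapWord v)
    (hu' : IsCupWord u') (hv' : IsCapWord v') :
    maxSummand (v ≫ u) ≫ maxSummand (v' ≫ u') =
      v ≫ (jonesWenzl k l ≫ u ≫ v' ≫ jonesWenzl k l') ≫ u' := by
  simp only [maxSummand_cap_comp_cup hv hu, maxSummand_cap_comp_cup hv' hu', Category.assoc]

theorem maxSummand_comp_self {l m n p : ℕ} {u : of k l ⟶ of k n} {v : of k m ⟶ of k l}
    {u' : of k l ⟶ of k p} (hu : IsCupWord u) (hv : IsCapWord v) (hu' : IsCupWord u') :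
    maxSummand (v ≫ u) ≫ maxSummand (bar u ≫ u') = maxSummand (v ≫ u') := by
  rw [maxSummand_comp_maxSummand hu hv hu' hu.bar, jonesWenzl_sandwich_self hu,
    maxSummand_cap_comp_cup hv hu']

theorem maxSummand_comp_eq_zero {l l' m n p : ℕ} {u : of k l ⟶ of k n} {v : of k m ⟶ of k l}
    {u' : of k l' ⟶ of k p} {v' : of k n ⟶ of k l'} (hu : IsCupWord u) (hv : IsCapWord v)
    (hu' : IsCupWord u') (hv' : IsCapWord v')
    (h : (⟨l, u⟩ : Σ l, (of k l ⟶ of k n)) ≠ ⟨l', bar v'⟩) :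
    maxSummand (v ≫ u) ≫ maxSummand (v' ≫ u') = 0 := by
  rw [maxSummand_comp_maxSummand hu hv hu' hv', jonesWenzl_sandwich_eq_zero hu hv' h,
    Limits.zero_comp, Limits.comp_zero]

theorem lowerSpan_le_span_maxSummand (m n c : ℕ) :
    lowerSpan k m n c ≤
      Submodule.span k (Set.range fun x : {x : of k m ⟶ of k n // IsTLDiagram x} =>
        maxSummand x.1) := by
  induction c using Nat.strong_induction_on with
  | _ c ih =>
    rw [lowerSpan, Submodule.span_le]
    rintro _ ⟨j, hj, v, u, hv, hu, rfl⟩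
    have h : v ≫ u = maxSummand (v ≫ u) - v ≫ (jonesWenzl k j - 𝟙 _) ≫ u := by
      rw [maxSummand_cap_comp_cup hv hu, Preadditive.sub_comp, Preadditive.comp_sub,
        Category.id_comp, sub_sub_cancel]
    rw [h]
    refine sub_mem (Submodule.subset_span ⟨⟨_, isTLDiagram_cap_comp_cup hv hu⟩, rfl⟩)
      (ih j hj ?_)
    have hle : lowerSpan k j j j ≤ (lowerSpan k m n j).comap
        (Linear.leftComp k (of k n) v ∘ₗ Linear.rightComp k (of k j) u) := by
      rw [lowerSpan, Submodule.span_le]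
      rintro _ ⟨i, hi, a, b, ha, hb, rfl⟩
      exact Submodule.subset_span ⟨i, hi, v ≫ a, b ≫ u, .comp hv ha, .comp hb hu, by simp⟩
    exact hle (jonesWenzl_sub_id_mem j)

/-- The span of all diagrams from `m` to `n`. -/
def diagramSpan (k : Type u) [Field k] (m n : ℕ) : Submodule k (of k m ⟶ of k n) :=
  Submodule.span k {f | IsWord f}

theorem comp_mem_diagramSpan {l m n : ℕ} {f : of k l ⟶ of k m} {g : of k m ⟶ of k n}
    (hf : f ∈ diagramSpan k l m) (hg : g ∈ diagramSpan k m n) : f ≫ g ∈ diagramSpan k l n := by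
  induction hf using Submodule.span_induction with
  | mem f hf =>
    induction hg using Submodule.span_induction with
    | mem g hg => exact Submodule.subset_span (.comp hf hg)
    | zero => rw [Limits.comp_zero]; exact zero_mem _
    | add _ _ _ _ h h' => rw [Preadditive.comp_add]; exact add_mem h h'
    | smul c _ _ h => rw [Linear.comp_smul]; exact Submodule.smul_mem _ _ h
  | zero => rw [Limits.zero_comp]; exact zero_mem _
  | add _ _ _ _ h h' => rw [Preadditive.add_comp]; exact add_mem h h'
  | smul c _ _ h => rw [Linear.smul_comp]; exact Submodule.smul_mem _ _ h

theorem tensor_mem_diagramSpan {m n p q : ℕ} {f : of k m ⟶ of k n} {g : of k p ⟶ of k q}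
    (hf : f ∈ diagramSpan k m n) (hg : g ∈ diagramSpan k p q) :
    tensor f g ∈ diagramSpan k (m + p) (n + q) := by
  induction hf using Submodule.span_induction with
  | mem f hf =>
    induction hg using Submodule.span_induction with
    | mem g hg => exact Submodule.subset_span (.tensor hf hg)
    | zero => rw [tensor_zero]; exact zero_mem _
    | add _ _ _ _ h h' => rw [tensor_add]; exact add_mem h h'
    | smul c _ _ h => rw [tensor_smul]; exact Submodule.smul_mem _ _ h
  | zero => rw [zero_tensor]; exact zero_mem _
  | add _ _ _ _ h h' => rw [add_tensor]; exact add_mem h h'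
  | smul c _ _ h => rw [smul_tensor]; exact Submodule.smul_mem _ _ h

theorem mk_mem_diagramSpan {m n : ℕ} (f : Pre k m n) :
    (Quotient.mk (relSetoid k m n) f : of k m ⟶ of k n) ∈ diagramSpan k m n := by
  induction f with
  | id n => exact Submodule.subset_span (.id n)
  | cup => exact Submodule.subset_span .cup
  | cap => exact Submodule.subset_span .cap
  | comp f g hf hg => exact comp_mem_diagramSpan hf hg
  | tensor f g hf hg => exact tensor_mem_diagramSpan hf hg
  | zero m n => exact zero_mem (diagramSpan k m n)
  | @add m n f g hf hg => exact (diagramSpan k m n).add_mem hf hg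
  | @smul m n c f hf => exact (diagramSpan k m n).smul_mem c hf

theorem mem_diagramSpan {m n : ℕ} (f : of k m ⟶ of k n) : f ∈ diagramSpan k m n := by
  induction f using Quotient.inductionOn with | _ f
  exact mk_mem_diagramSpan f

theorem span_maxSummand_eq_top (m n : ℕ) :
    Submodule.span k (Set.range fun x : {x : of k m ⟶ of k n // IsTLDiagram x} =>
      maxSummand x.1) = ⊤ := by
  rw [eq_top_iff]
  intro f _
  have hle : diagramSpan k m n ≤ Submodule.span k
      (Set.range fun x : {x : of k m ⟶ of k n // IsTLDiagram x} => maxSummand x.1) := by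
    rw [diagramSpan, Submodule.span_le]
    intro x hx
    obtain rfl | ⟨j, v, u, hv, hu, rfl⟩ := IsWord.isReduced hx
    · exact zero_mem _
    · exact lowerSpan_le_span_maxSummand m n (j + 1)
        (cap_comp_cup_mem_lowerSpan hv hu j.lt_succ_self)
  exact hle (mem_diagramSpan f)

theorem linearIndependent_maxSummand (m n : ℕ) :
    LinearIndependent k fun x : {x : of k m ⟶ of k n // IsTLDiagram x} => maxSummand x.1 := by
  rw [linearIndependent_iff']
  rintro s c hs ⟨x, hx⟩ hxs
  obtain ⟨l, u, v, h⟩ := hx.exists_isCupCap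
  obtain ⟨hu, hv, rfl⟩ := isCupCap_iff.mp h
  let T : (of k m ⟶ of k n) →ₗ[k] (of k l ⟶ of k l) :=
    Linear.leftComp k (of k l) (jonesWenzl k l ≫ bar v) ∘ₗ
      Linear.rightComp k (of k m) (bar u ≫ jonesWenzl k l)
  have hT : ∀ f, T f = (jonesWenzl k l ≫ bar v) ≫ f ≫ bar u ≫ jonesWenzl k l := fun f => rfl
  have h₁ : T (maxSummand (v ≫ u)) = jonesWenzl k l := by
    rw [hT, maxSummand_cap_comp_cup hv hu]
    simp only [Category.assoc]
    rw [jonesWenzl_sandwich_self hu, ← Category.assoc (bar v), hv.bar_comp, Category.id_comp,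
      jonesWenzl_comp_self]
  have h₂ : ∀ y : {x : of k m ⟶ of k n // IsTLDiagram x}, y.1 ≠ v ≫ u →
      T (maxSummand y.1) = 0 := by
    rintro ⟨y, hy⟩ hne
    obtain ⟨l', u', v', h'⟩ := hy.exists_isCupCap
    obtain ⟨hu', hv', rfl⟩ := isCupCap_iff.mp h'
    have hassoc : T (maxSummand (v' ≫ u')) =
        (jonesWenzl k l ≫ bar v ≫ v' ≫ jonesWenzl k l') ≫ u' ≫ bar u ≫ jonesWenzl k l := by
      rw [hT, maxSummand_cap_comp_cup hv' hu']
      simp only [Category.assoc]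
    by_cases hl : (⟨l, bar v⟩ : Σ l, (of k l ⟶ of k m)) = ⟨l', bar v'⟩
    · obtain rfl : l = l' := congrArg Sigma.fst hl
      have hvv : v = v' := by
        rw [← bar_bar v, ← bar_bar v', eq_of_heq (Sigma.mk.inj hl).2]
      subst hvv
      have hur : (⟨l, u'⟩ : Σ l, (of k l ⟶ of k n)) ≠ ⟨l, bar (bar u)⟩ := by
        intro h
        rw [bar_bar] at h
        exact hne (congrArg (v ≫ ·) (eq_of_heq (Sigma.mk.inj h).2))
      have h₃ := jonesWenzl_sandwich_eq_zero hu' hu.bar hur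
      rw [hassoc, ← Category.assoc (bar v), hv.bar_comp, Category.id_comp, jonesWenzl_comp_self, h₃]
    · rw [hassoc, jonesWenzl_sandwich_eq_zero hv.bar hv' hl, Limits.zero_comp]
  have h₄ := congrArg T hs
  rw [map_zero, map_sum, Finset.sum_eq_single_of_mem _ hxs, map_smul, h₁] at h₄
  · exact (smul_eq_zero.mp h₄).resolve_right (jonesWenzl_ne_zero l)
  · intro y _ hy
    rw [map_smul, h₂ y fun h => hy (Subtype.ext h), smul_zero]

/-- The basis of max-summand morphisms. -/
noncomputable def maxSummandBasis (k : Type u) [Field k] (m n : ℕ) :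
    Module.Basis {x : of k m ⟶ of k n // IsTLDiagram x} k (of k m ⟶ of k n) :=
  Module.Basis.mk (linearIndependent_maxSummand m n) (span_maxSummand_eq_top m n).ge

theorem maxSummandBasis_apply {m n : ℕ} (x : {x : of k m ⟶ of k n // IsTLDiagram x}) :
    maxSummandBasis k m n x = maxSummand x.1 := Module.Basis.mk_apply _ _ _

/-! ### Endomorphism algebras -/

instance finite_cupDiagram (l m : ℕ) : Finite (CupDiagram k l m) :=
  Finite.of_surjective (fun w : Ballot l m => ⟨w.diagram k, w.isCupWord.isCupDiagram⟩)
    fun ⟨_, hu⟩ => hu.1.exists_ballot.imp fun _ h => Subtype.ext h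

theorem matrixUnit_eq_maxSummand {l m : ℕ} (a b : CupDiagram k l m) :
    matrixUnit a b = maxSummand (bar b.1 ≫ a.1) :=
  (maxSummand_cap_comp_cup b.2.1.bar a.2.1).symm

theorem matrixUnit_mul_self {l m : ℕ} (a b c : CupDiagram k l m) :
    matrixUnit a b * matrixUnit b c = matrixUnit a c := by
  simp only [matrixUnit_eq_maxSummand, End.mul_def]
  exact maxSummand_comp_self b.2.1 c.2.1.bar a.2.1

theorem matrixUnit_mul_eq_zero {l l' m : ℕ} (a b : CupDiagram k l m) (c d : CupDiagram k l' m)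
    (h : (⟨l, b⟩ : Σ l, CupDiagram k l m) ≠ ⟨l', c⟩) :
    matrixUnit a b * matrixUnit c d = 0 := by
  simp only [matrixUnit_eq_maxSummand, End.mul_def]
  refine maxSummand_comp_eq_zero c.2.1 d.2.1.bar a.2.1 b.2.1.bar fun h' => h ?_
  obtain rfl : l' = l := congrArg Sigma.fst h'
  rw [bar_bar] at h'
  rw [Subtype.ext (eq_of_heq (Sigma.mk.inj h').2)]

theorem endThrough_eq_span (l m : ℕ) :
    endThrough k l m = Submodule.span k
      (Set.range fun p : CupDiagram k l m × CupDiagram k l m => matrixUnit p.1 p.2) := by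
  refine congrArg _ (Set.ext fun f => ⟨?_, ?_⟩)
  · rintro ⟨x, hx, hl, rfl⟩
    obtain ⟨l', u, v, h⟩ := hx.exists_isCupCap
    obtain ⟨hu, hv, rfl⟩ := isCupCap_iff.mp h
    obtain rfl : l' = l := (through_cap_comp_cup hv hu).symm.trans hl
    refine ⟨⟨⟨u, hu.isCupDiagram⟩, ⟨bar v, hv.bar.isCupDiagram⟩⟩, ?_⟩
    exact (matrixUnit_eq_maxSummand _ _).trans (by rw [bar_bar])
  · rintro ⟨⟨a, b⟩, rfl⟩
    exact ⟨bar b.1 ≫ a.1, isTLDiagram_cap_comp_cup b.2.1.bar a.2.1,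
      through_cap_comp_cup b.2.1.bar a.2.1, (matrixUnit_eq_maxSummand a b).symm⟩

/-- The diagrams `m ⟶ m` correspond to pairs of cup diagrams with the same source. -/
noncomputable def diagramEquiv (k : Type u) [Field k] (m : ℕ) :
    (Σ l : Fin (m + 1), CupDiagram k l m × CupDiagram k l m) ≃
      {x : of k m ⟶ of k m // IsTLDiagram x} := by
  refine Equiv.ofBijective (fun p => ⟨bar p.2.2.1 ≫ p.2.1.1,
    isTLDiagram_cap_comp_cup p.2.2.2.1.bar p.2.1.2.1⟩) ⟨?_, ?_⟩
  · rintro ⟨l, ⟨u, hu⟩, ⟨v, hv⟩⟩ ⟨l', ⟨u', hu'⟩, ⟨v', hv'⟩⟩ h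
    have h' : bar v ≫ u = bar v' ≫ u' := congrArg Subtype.val h
    have hl : (l : ℕ) = l' := by
      rw [← through_cap_comp_cup hv.1.bar hu.1, h', through_cap_comp_cup hv'.1.bar hu'.1]
    obtain rfl := Fin.ext hl
    obtain ⟨rfl, h₂⟩ := cap_comp_cup_injective hv.1.bar hu.1 hv'.1.bar hu'.1 h'
    obtain rfl : v = v' := by rw [← bar_bar v, h₂, bar_bar]
    rfl
  · rintro ⟨x, hx⟩
    obtain ⟨l, u, v, h⟩ := hx.exists_isCupCap
    obtain ⟨hu, hv, rfl⟩ := isCupCap_iff.mp h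
    refine ⟨⟨⟨l, Nat.lt_succ_of_le hu.le⟩, ⟨u, hu.isCupDiagram⟩, ⟨bar v, hv.bar.isCupDiagram⟩⟩, ?_⟩
    exact Subtype.ext (congrArg (· ≫ u) (bar_bar v))

/-- An algebra with a basis that multiplies like the matrix units of a product of matrix algebras is
this product. -/
theorem exists_algEquiv_pi_matrix {ι A : Type*} [Fintype ι] [DecidableEq ι] {n : ι → Type*}
    [∀ i, Fintype (n i)] [∀ i, DecidableEq (n i)] [Ring A] [Algebra k A]
    (B : Module.Basis (Σ i, n i × n i) k A)
    (h₁ : ∀ i a b c, B ⟨i, a, b⟩ * B ⟨i, b, c⟩ = B ⟨i, a, c⟩)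
    (h₂ : ∀ i a b j c d, (⟨i, b⟩ : Σ i, n i) ≠ ⟨j, c⟩ → B ⟨i, a, b⟩ * B ⟨j, c, d⟩ = 0) :
    ∃ Φ : A ≃ₐ[k] (∀ i, Matrix (n i) (n i) k),
      ∀ i a b, Φ (B ⟨i, a, b⟩) = Pi.single i (Matrix.single a b 1) := by
  let C : Module.Basis (Σ i, n i × n i) k (∀ i, Matrix (n i) (n i) k) :=
    Pi.basis fun i => Matrix.stdBasis k (n i) (n i)
  let Φ : A ≃ₗ[k] (∀ i, Matrix (n i) (n i) k) := B.equiv C (Equiv.refl _)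
  have hΦ : ∀ i a b, Φ (B ⟨i, a, b⟩) = Pi.single i (Matrix.single a b 1) := by
    intro i a b
    rw [Module.Basis.equiv_apply, Equiv.refl_apply, Pi.basis_apply, Matrix.stdBasis_eq_single]
  have hmul : ∀ x y, Φ (x * y) = Φ x * Φ y := by
    have h : (LinearMap.mul k A).compr₂ Φ.toLinearMap =
        (LinearMap.mul k (∀ i, Matrix (n i) (n i) k)).compl₁₂ Φ.toLinearMap Φ.toLinearMap := by
      refine B.ext fun ⟨i, a, b⟩ => B.ext fun ⟨j, c, d⟩ => ?_
      change Φ (B ⟨i, a, b⟩ * B ⟨j, c, d⟩) = Φ (B ⟨i, a, b⟩) * Φ (B ⟨j, c, d⟩)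
      by_cases h : (⟨i, b⟩ : Σ i, n i) = ⟨j, c⟩
      · obtain rfl : i = j := congrArg Sigma.fst h
        obtain rfl : b = c := eq_of_heq (Sigma.mk.inj h).2
        rw [h₁, hΦ, hΦ, hΦ, ← Pi.single_mul, Matrix.single_mul_single_same, mul_one]
      · rw [h₂ _ _ _ _ _ _ h, map_zero, hΦ, hΦ]
        by_cases hij : i = j
        · subst hij
          have hbc : b ≠ c := fun hbc => h (by rw [hbc])
          rw [← Pi.single_mul, Matrix.single_mul_single_of_ne 1 a b c hbc 1, Pi.single_zero]
        · funext i'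
          by_cases hi' : i' = i
          · subst hi'
            rw [Pi.mul_apply, Pi.single_eq_of_ne (i := j) hij, mul_zero]
            rfl
          · rw [Pi.mul_apply, Pi.single_eq_of_ne hi', zero_mul]
            rfl
    exact fun x y => LinearMap.congr_fun (LinearMap.congr_fun h x) y
  have hone : Φ 1 = 1 := by
    obtain ⟨x, hx⟩ := Φ.surjective 1
    rw [← mul_one (Φ 1), ← hx, ← hmul, one_mul]
  exact ⟨AlgEquiv.ofLinearEquiv Φ hone hmul, hΦ⟩

/-- The algebra isomorphism attached to enumerations of the cup diagrams. -/
theorem exists_algEquiv_end {m : ℕ}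
    (e : ∀ l : Fin (m + 1), Fin (cupCount k l m) ≃ CupDiagram k l m) :
    ∃ Φ : End (of k m) ≃ₐ[k]
        (∀ l : Fin (m + 1), Matrix (Fin (cupCount k l m)) (Fin (cupCount k l m)) k),
      ∀ l a b, Φ (matrixUnit (e l a) (e l b)) = Pi.single l (Matrix.single a b 1) := by
  let B : Module.Basis (Σ l : Fin (m + 1), Fin (cupCount k l m) × Fin (cupCount k l m)) k
      (End (of k m)) :=
    (maxSummandBasis k m m).reindex
      ((Equiv.sigmaCongrRight fun l => (e l).prodCongr (e l)).trans (diagramEquiv k m)).symm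
  have hB : ∀ l a b, B ⟨l, a, b⟩ = matrixUnit (e l a) (e l b) := by
    intro l a b
    rw [matrixUnit_eq_maxSummand]
    exact (Module.Basis.reindex_apply _ _ _).trans (maxSummandBasis_apply _)
  obtain ⟨Φ, hΦ⟩ := exists_algEquiv_pi_matrix B
    (fun i a b c => by rw [hB, hB, hB, matrixUnit_mul_self])
    (fun i a b j c d h => by
      rw [hB, hB]
      refine matrixUnit_mul_eq_zero _ _ _ _ fun h' => h ?_
      obtain rfl : i = j := Fin.ext (congrArg Sigma.fst h')
      rw [(e i).injective (eq_of_heq (Sigma.mk.inj h').2)])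
  exact ⟨Φ, fun l a b => by rw [← hB, hΦ]⟩

theorem mem_endThrough_iff {m : ℕ}
    {e : ∀ l : Fin (m + 1), Fin (cupCount k l m) ≃ CupDiagram k l m}
    (Φ : End (of k m) ≃ₐ[k]
        (∀ l : Fin (m + 1), Matrix (Fin (cupCount k l m)) (Fin (cupCount k l m)) k))
    (hΦ : ∀ l a b, Φ (matrixUnit (e l a) (e l b)) = Pi.single l (Matrix.single a b 1))
    (l : Fin (m + 1)) (x : End (of k m)) :
    x ∈ endThrough k l m ↔ Φ x = Pi.single l (Φ x l) := by
  rw [endThrough_eq_span]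
  constructor
  · intro hx
    induction hx using Submodule.span_induction with
    | mem x hx =>
      obtain ⟨⟨a, b⟩, rfl⟩ := hx
      obtain ⟨a, rfl⟩ := (e l).surjective a
      obtain ⟨b, rfl⟩ := (e l).surjective b
      simp only [hΦ, Pi.single_eq_same]
    | zero => simp
    | add x y _ _ hx hy => rw [map_add, Pi.add_apply, Pi.single_add, ← hx, ← hy]
    | smul c x _ hx => rw [map_smul, Pi.smul_apply, Pi.single_smul, ← hx]
  · intro hx
    have h : x = ∑ a, ∑ b, Φ x l a b • matrixUnit (e l a) (e l b) := by
      apply Φ.injective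
      conv_lhs => rw [hx, Matrix.matrix_eq_sum_single (Φ x l)]
      simp only [map_sum, map_smul, hΦ, ← Pi.single_smul]
      simp only [Matrix.smul_single, smul_eq_mul, mul_one]
      rw [← AddMonoidHom.single_apply]
      simp only [map_sum, AddMonoidHom.single_apply]
    rw [h]
    exact sum_mem fun a _ => sum_mem fun b _ =>
      Submodule.smul_mem _ _ (Submodule.subset_span ⟨(e l a, e l b), rfl⟩)

end TLZero

open TLZero in
theorem mainTheorem6 (k : Type u) [Field k] :
    -- every diagram is uniquely `u ∘ v`, through `th x` strands, and every `u ∘ v` is a diagram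
    (∀ (m n : ℕ) (x : of k m ⟶ of k n), IsTLDiagram x →
      ∃! p : Σ l : ℕ, (of k l ⟶ of k n) × (of k m ⟶ of k l), IsCupCap x p.2.1 p.2.2) ∧
    (∀ (l m n : ℕ) (u : of k l ⟶ of k n) (v : of k m ⟶ of k l),
      IsCupDiagram u → IsCapDiagram v →
        IsTLDiagram (v ≫ u) ∧ through (v ≫ u) = l ∧
          maxSummand (v ≫ u) = v ≫ jonesWenzl k l ≫ u) ∧
    -- the max-summand morphisms form a basis of each Hom space
    (∀ m n : ℕ, ∃ B : Module.Basis {x : of k m ⟶ of k n // IsTLDiagram x} k (of k m ⟶ of k n),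
      ∀ x, B x = maxSummand x.1) ∧
    -- they multiply like matrix units: `x = u ∘ v : m ⟶ n` followed by `x' = u' ∘ v' : n ⟶ p`
    (∀ (l m n p : ℕ) (u : of k l ⟶ of k n) (v : of k m ⟶ of k l)
      (u' : of k l ⟶ of k p) (v' : of k n ⟶ of k l),
      IsCupDiagram u → IsCapDiagram v → IsCupDiagram u' → IsCapDiagram v' →
        (v' = bar u → maxSummand (v ≫ u) ≫ maxSummand (v' ≫ u') = maxSummand (v ≫ u')) ∧
        (v' ≠ bar u → maxSummand (v ≫ u) ≫ maxSummand (v' ≫ u') = 0)) ∧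
    (∀ (l l' m n p : ℕ) (u : of k l ⟶ of k n) (v : of k m ⟶ of k l)
      (u' : of k l' ⟶ of k p) (v' : of k n ⟶ of k l'),
      IsCupDiagram u → IsCapDiagram v → IsCupDiagram u' → IsCapDiagram v' → l ≠ l' →
        maxSummand (v ≫ u) ≫ maxSummand (v' ≫ u') = 0) ∧
    -- the endomorphism algebras
    (∀ m : ℕ,
      (∀ l : ℕ, Finite (CupDiagram k l m)) ∧
      ∃ S : Fin (m + 1) → NonUnitalSubalgebra k (End (of k m)),
        (∀ l, (S l).toSubmodule = endThrough k l m) ∧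
        (∃ Ψ : (∀ l, S l) →ₙₐ[k] End (of k m),
          Function.Bijective Ψ ∧ ∀ y, Ψ y = ∑ l, (y l : End (of k m))) ∧
        ∀ e : ∀ l : Fin (m + 1), Fin (cupCount k l m) ≃ CupDiagram k l m,
          (∀ l, ∃ φ : S l →ₙₐ[k] Matrix (Fin (cupCount k l m)) (Fin (cupCount k l m)) k,
            Function.Bijective φ ∧
              ∀ a b, ∃ h : matrixUnit (e l a) (e l b) ∈ S l,
                φ ⟨matrixUnit (e l a) (e l b), h⟩ = Matrix.single a b 1) ∧
          ∃ Φ : End (of k m) ≃ₐ[k]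
              (∀ l : Fin (m + 1), Matrix (Fin (cupCount k l m)) (Fin (cupCount k l m)) k),
            ∀ l a b, Φ (matrixUnit (e l a) (e l b)) = Pi.single l (Matrix.single a b 1)) := by
  refine ⟨?_, ?_, ?_, ?_, ?_, ?_⟩
  · intro m n x hx
    obtain ⟨l, u, v, h⟩ := hx.exists_isCupCap
    exact ⟨⟨l, u, v⟩, h, fun p hp => IsCupCap.unique hp h⟩
  · intro l m n u v hu hv
    exact ⟨isTLDiagram_cap_comp_cup hv.1 hu.1, through_cap_comp_cup hv.1 hu.1,
      maxSummand_cap_comp_cup hv.1 hu.1⟩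
  · exact fun m n => ⟨maxSummandBasis k m n, maxSummandBasis_apply⟩
  · intro l m n p u v u' v' hu hv hu' hv'
    constructor
    · rintro rfl
      exact maxSummand_comp_self hu.1 hv.1 hu'.1
    · refine fun h => maxSummand_comp_eq_zero hu.1 hv.1 hu'.1 hv'.1 fun h' => h ?_
      rw [eq_of_heq (Sigma.mk.inj h').2, bar_bar]
  · exact fun l l' m n p u v u' v' hu hv hu' hv' hl =>
      maxSummand_comp_eq_zero hu.1 hv.1 hu'.1 hv'.1 fun h' => hl (congrArg Sigma.fst h')
  · intro m
    refine ⟨fun l => inferInstance, ?_⟩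
    obtain ⟨Φ₀, hΦ₀⟩ := exists_algEquiv_end (k := k) (m := m) fun l =>
      (Finite.equivFin (CupDiagram k l m)).symm
    let S : Fin (m + 1) → NonUnitalSubalgebra k (End (of k m)) := fun l =>
      { endThrough k l m with
        mul_mem' := by
          intro x y hx hy
          have hx := (mem_endThrough_iff Φ₀ hΦ₀ l x).mp hx
          have hy := (mem_endThrough_iff Φ₀ hΦ₀ l y).mp hy
          refine (mem_endThrough_iff Φ₀ hΦ₀ l (x * y)).mpr ?_
          rw [map_mul, Pi.mul_apply, Pi.single_mul, ← hx, ← hy] }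
    have hS : ∀ l x, x ∈ S l ↔ Φ₀ x = Pi.single l (Φ₀ x l) := mem_endThrough_iff Φ₀ hΦ₀
    have hsum : ∀ (y : ∀ l, S l) (l), Φ₀ (∑ l, (y l : End (of k m))) l = Φ₀ (y l : End (of k m)) l := by
      intro y l
      rw [map_sum, Finset.sum_apply, Finset.sum_eq_single l]
      · intro l' _ hl'
        rw [(hS l' _).mp (y l').2, Pi.single_eq_of_ne hl'.symm]
      · exact fun h => absurd (Finset.mem_univ l) h
    refine ⟨S, fun l => rfl, ⟨{
      toFun := fun y => ∑ l, (y l : End (of k m))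
      map_smul' := fun c y => Finset.smul_sum.symm
      map_zero' := Finset.sum_const_zero
      map_add' := fun y z => Finset.sum_add_distrib
      map_mul' := fun y z => Φ₀.injective <| funext fun l => by
        refine (hsum (y * z) l).trans ?_
        refine (congrFun (map_mul Φ₀ (y l : End (of k m)) (z l)) l).trans ?_
        rw [Pi.mul_apply, ← hsum y, ← hsum z]
        exact (congrFun (map_mul Φ₀ _ _) l).symm }, ⟨?_, ?_⟩, fun y => rfl⟩, ?_⟩
    · intro y z hyz
      funext l
      refine Subtype.ext (Φ₀.injective ?_)
      rw [(hS l _).mp (y l).2, (hS l _).mp (z l).2, ← hsum, ← hsum]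
      exact congrArg (Pi.single l) (congrFun (congrArg Φ₀ hyz) l)
    · intro x
      refine ⟨fun l => ⟨Φ₀.symm (Pi.single l (Φ₀ x l)), (hS l _).mpr (by simp)⟩, ?_⟩
      refine Φ₀.injective (funext fun l => (hsum _ l).trans ?_)
      simp
    · intro e
      obtain ⟨Φ, hΦ⟩ := exists_algEquiv_end e
      have hS' : ∀ l x, x ∈ S l ↔ Φ x = Pi.single l (Φ x l) := mem_endThrough_iff Φ hΦ
      refine ⟨fun l => ⟨{
        toFun := fun x => Φ x l
        map_smul' := fun c x => congrFun (map_smul Φ c (x : End (of k m))) l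
        map_zero' := congrFun (map_zero Φ) l
        map_add' := fun x y => congrFun (map_add Φ (x : End (of k m)) y) l
        map_mul' := fun x y => congrFun (map_mul Φ (x : End (of k m)) y) l }, ⟨?_, ?_⟩, ?_⟩, Φ, hΦ⟩
      · intro x y hxy
        refine Subtype.ext (Φ.injective ?_)
        rw [(hS' l _).mp x.2, (hS' l _).mp y.2]
        exact congrArg (Pi.single l) hxy
      · intro M
        refine ⟨⟨Φ.symm (Pi.single l M), (hS' l _).mpr (by simp)⟩, ?_⟩
        change Φ (Φ.symm (Pi.single l M)) l = M
        rw [AlgEquiv.apply_symm_apply, Pi.single_eq_same]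
      · intro a b
        refine ⟨(hS' l _).mpr (by simp [hΦ]), ?_⟩
        change Φ (matrixUnit (e l a) (e l b)) l = _
        rw [hΦ, Pi.single_eq_same]
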